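/- Let $\mathbb K$ be $\mathbb R$ or $\mathbb C$. Call $w:\mathbb R^N\to(0,\infty)$ a symmetric fast growing weight if it is continuous, $w(-x)=w(x)$ for all $x$, and $\sup_{x\in\mathbb R^N}(1+|x|)^m/w(x)<\infty$ for every $m\in\mathbb N$. For $1\le p<\infty$ let $L^p_w(\mathbb R^N)$ be the Banach space of (classes of) measurable $f:\mathbb R^N\to\mathbb K$ with $\|f\|_{p,w}=\big(\int_{\mathbb R^N}|f(x)|^p w(x)\,dx\big)^{1/p}<\infty$. For $f\in L^1(\mathbb R^N)$ and $t>0$ put $$e^{t\Delta}f(x)=\frac1{(4\pi t)^{N/2}}\int_{\mathbb R^N}e^{-|x-y|^2/(4t)}f(y)\,dy ,\qquad \|e^{t\Delta}f\|_\infty=\sup_{x\in\mathbb R^N}|e^{t\Delta}f(x)| .$$ Say that a Schauder basis $(e_n)_{n\ge1}$ of $L^p_w(\mathbb R^N)$ has the fast decay property if for every $m\in\mathbb N$ there are $n_m\in\mathbb N$ and a constant $C$ such that every $f=\sum_{n\ge1}f_ne_n\in L^p_w(\mathbb R^N)$ with $f_n=0$ for $n=1,\dots,n_m$ is integrable on $\mathbb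 R^N$ and satisfies $$\|e^{t\Delta}f\|_\infty\le\frac{C}{t^m}\,\|f\|_{p,w}\qquad\text{for all }t\ge1 .$$ **Theorem 1.1.** Let $1\le p<\infty$. 1. Let $w$ be a symmetric fast growing weight on $\mathbb R$. Then $L^p_w(\mathbb R)$ has a Schauder basis with the fast decay property. 2. Let $N>1$ and let $w$ be a symmetric fast growing weight on $\mathbb R^N$. Then there is a symmetric fast growing weight $\tilde w$ on $\mathbb R^N$ such that $L^p_w(\mathbb R^N)\subset L^1_{\tilde w}(\mathbb R^N)$ and $L^1_{\tilde w}(\mathbb R^N)$ has a Schauder basis with the fast decay property (with $p=1$ and $\tilde w$ in place of $w$). -/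

import Mathlib

open MeasureTheory
open scoped ENNReal

/-- A fast growing symmetric weight: a continuous, strictly positive, even function `w` such that
`(1 + ‖x‖) ^ m / w x` is bounded for every `m`. -/
structure IsFastGrowingWeight {E : Type*} [NormedAddCommGroup E] (w : E → ℝ) : Prop where
  continuous : Continuous w
  pos : ∀ x, 0 < w x
  symm : ∀ x, w (-x) = w x
  fast : ∀ m : ℕ, BddAbove (Set.range fun x => 1 / w x * (1 + ‖x‖) ^ m)

/-- The weighted Lebesgue measure `w(x) dx`. The weighted space with norm
`(∫ |f(x)| ^ p w(x) dx) ^ (1 / p)` is `Lp 𝕜 p (weightedMeasure w)`. -/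
noncomputable def weightedMeasure {E : Type*} [MeasureSpace E] (w : E → ℝ) : Measure E :=
  (volume : Measure E).withDensity fun x => ENNReal.ofReal (w x)

/-- The solution at time `t` of the heat equation on the Euclidean space `E` with initial data `f`:
`(4 π t) ^ (- dim E / 2) ∫ exp (- |x - y| ^ 2 / (4 t)) f(y) dy`. -/
noncomputable def heatSemigroup {𝕜 E : Type*} [RCLike 𝕜] [NormedAddCommGroup E]
    [InnerProductSpace ℝ E] [MeasureSpace E] (t : ℝ) (f : E → 𝕜) (x : E) : 𝕜 :=
  ((4 * Real.pi * t) ^ (-(Module.finrank ℝ E : ℝ) / 2) : ℝ) •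
    ∫ y, Real.exp (-‖x - y‖ ^ 2 / (4 * t)) • f y

/-- The supremum norm `sup |u(x)|`, with value `∞` for unbounded `u`. -/
noncomputable def supNorm {𝕜 E : Type*} [RCLike 𝕜] (u : E → 𝕜) : ℝ≥0∞ := ⨆ x, ‖u x‖ₑ

/-- The fast decay property of a Schauder basis `b` of the weighted `L^p` space: for every `m`
there are an index `n` and a constant `C` such that all initial data `f` whose first `n`
coordinates vanish are integrable and satisfy `‖e^{tΔ} f‖_∞ ≤ C t^{-m} ‖f‖_{p,w}` for `t ≥ 1`. -/
def HasFastDecay {𝕜 E : Type*} [RCLike 𝕜] [NormedAddCommGroup E] [InnerProductSpace ℝ E]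
    [MeasureSpace E] {p : ℝ≥0∞} [Fact (1 ≤ p)] {w : E → ℝ}
    (b : SchauderBasis 𝕜 (Lp 𝕜 p (weightedMeasure w))) : Prop :=
  ∀ m : ℕ, ∃ n : ℕ, ∃ C : ℝ, ∀ f : Lp 𝕜 p (weightedMeasure w), (∀ k < n, b.coord k f = 0) →
    Integrable (f : E → 𝕜) volume ∧
      ∀ t : ℝ, 1 ≤ t →
        supNorm (heatSemigroup t (f : E → 𝕜)) ≤ ENNReal.ofReal (C / t ^ m * ‖f‖)

/-! Decay of the heat flow comes from vanishing moments. After rescaling space by `√t`, the kernel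
is a fixed Gaussian. Its Taylor polynomial of degree below `2 * m` at the rescaled source point
contributes only moments of `f` of order below `2 * m`, and the remainder is at most a constant
times `‖y‖ ^ (2 * m) / t ^ m`, uniformly in the observation point (`exists_gaussian_taylor`,
`exists_norm_heatSemigroup_le`). The fast growing weight controls every absolute moment by the
weighted norm. It therefore suffices to find one Schauder basis such that each moment functional
vanishes on all `f` whose first few coordinates vanish.

This holds for any sequence of functionals `φ k` with `‖φ k - φ k ∘ P n‖ → 0` for the partial sum
projections `P n` of some basis. A small perturbation `T` of the identity moves the basis so that
each `φ k` depends on finitely many of the new coordinates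
(`SchauderBasis.exists_basis_annihilating`).

The starting basis is a Haar system for the measure `w(x) dx`, built from a binary tree of sets
whose partial sums are averages over partitions (`exists_haarBasis`). A moment functional is
integration against `q / w` for this measure. This density is continuous and its tails are uniformly
small on bounded sets, which gives the norm convergence.

The argument works in every dimension and for every finite `p`
(`IsFastGrowingWeight.exists_hasFastDecay`), so the second assertion only adds an embedding. It
holds with `w' = w ^ (1 / (2 * p))`: half of the growth of `w` remains available to pay for Hölder's
inequality. -/

open Filter Topology

/-! ### Perturbing a Schauder basis so that given functionals become finite in its coordinates. -/

section Perturbation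

variable {𝕜 X : Type*} [RCLike 𝕜] [NormedAddCommGroup X] [NormedSpace 𝕜 X]

/-- Gram-Schmidt biorthogonalisation of a sequence of functionals, where `y` selects a vector for
each functional. -/
noncomputable def biorthogonalSeq (φ : ℕ → StrongDual 𝕜 X) (y : StrongDual 𝕜 X → X) (n : ℕ) :
    StrongDual 𝕜 X × X :=
  let χ := φ n - ∑ i : Fin n, φ n (biorthogonalSeq φ y i).2 • (biorthogonalSeq φ y i).1
  (χ, y χ - ∑ i : Fin n, (biorthogonalSeq φ y i).1 (y χ) • (biorthogonalSeq φ y i).2)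
termination_by n
decreasing_by all_goals exact i.2

/-- Each new functional is corrected to kill the earlier vectors, and each new vector is corrected
to be killed by the earlier functionals. A functional dependent on its predecessors becomes zero,
paired with the zero vector, so no independence is needed. The norms of the vectors are not
controlled. -/
theorem exists_biorthogonal (φ : ℕ → StrongDual 𝕜 X) :
    ∃ (ψ : ℕ → StrongDual 𝕜 X) (x : ℕ → X), (∀ i j, i ≠ j → ψ i (x j) = 0) ∧
      (∀ i, ψ i (x i) = 1 ∨ ψ i = 0) ∧ (∀ k, ψ k ∈ Submodule.span 𝕜 (Set.range φ)) ∧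
      ∀ k, φ k ∈ Submodule.span 𝕜 (Set.range ψ) := by
  classical
  have single : ∀ χ : StrongDual 𝕜 X, ∃ y : X, χ y = 1 ∨ (χ = 0 ∧ y = 0) := fun χ => by
    by_cases h : χ = 0
    · exact ⟨0, Or.inr ⟨h, rfl⟩⟩
    · obtain ⟨y, hy⟩ : ∃ y, χ y ≠ 0 := by
        by_contra! hc
        exact h (ContinuousLinearMap.ext hc)
      exact ⟨(χ y)⁻¹ • y, Or.inl (by simp [hy])⟩
  choose y hy using single
  let ψ : ℕ → StrongDual 𝕜 X := fun n => (biorthogonalSeq φ y n).1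
  let x : ℕ → X := fun n => (biorthogonalSeq φ y n).2
  have hψ : ∀ n, ψ n = φ n - ∑ i ∈ Finset.range n, φ n (x i) • ψ i := by
    intro n
    simp only [ψ, x]
    rw [biorthogonalSeq, Finset.sum_range]
  have hx : ∀ n, x n = y (ψ n) - ∑ i ∈ Finset.range n, ψ i (y (ψ n)) • x i := by
    intro n
    rw [hψ n]
    simp only [ψ, x]
    rw [biorthogonalSeq, Finset.sum_range, Finset.sum_range]
  have key : ∀ n, (∀ i < n, ψ n (x i) = 0 ∧ ψ i (x n) = 0) ∧
      (ψ n (x n) = 1 ∨ (ψ n = 0 ∧ x n = 0)) := by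
    intro n
    induction n using Nat.strong_induction_on with
    | _ n ih =>
      have ortho : ∀ i < n, ∀ j < n, j ≠ i → ψ i (x j) = 0 := fun i hi j hj hij => by
        rcases lt_or_gt_of_ne hij with h | h
        · exact ((ih i hi).1 j h).1
        · exact ((ih j hj).1 i h).2
      have h1 : ∀ i < n, ψ n (x i) = 0 := fun i hi => by
        rcases (ih i hi).2 with h | ⟨-, h⟩
        · rw [hψ, sub_apply, sum_apply,
            Finset.sum_eq_single i]
          · simp [h]
          · intro j hj hji
            simp [ortho j (Finset.mem_range.1 hj) i hi hji.symm]
          · intro h'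
            exact absurd (Finset.mem_range.2 hi) h'
        · rw [h, map_zero]
      have h2 : ∀ i < n, ψ i (x n) = 0 := fun i hi => by
        rcases (ih i hi).2 with h | ⟨h, -⟩
        · rw [hx, map_sub, map_sum, Finset.sum_eq_single i]
          · simp [h]
          · intro j hj hji
            simp [ortho i hi j (Finset.mem_range.1 hj) hji]
          · intro h'
            exact absurd (Finset.mem_range.2 hi) h'
        · simp [h]
      refine ⟨fun i hi => ⟨h1 i hi, h2 i hi⟩, ?_⟩
      rcases hy (ψ n) with h | ⟨h, h'⟩
      · left
        rw [hx, map_sub, h, map_sum, Finset.sum_eq_zero, sub_zero]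
        intro i hi
        simp [h1 i (Finset.mem_range.1 hi)]
      · right
        refine ⟨h, ?_⟩
        rw [hx, h']
        simp
  refine ⟨ψ, x, fun i j hij => ?_, fun i => (key i).2.imp_right And.left, fun k => ?_, fun k => ?_⟩
  · rcases lt_or_gt_of_ne hij with h | h
    · exact ((key j).1 i h).2
    · exact ((key i).1 j h).1
  · induction k using Nat.strong_induction_on with
    | _ k ih =>
      rw [hψ]
      exact Submodule.sub_mem _ (Submodule.subset_span ⟨k, rfl⟩) (Submodule.sum_mem _ fun i hi =>
        Submodule.smul_mem _ _ (ih i (Finset.mem_range.1 hi)))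
  · rw [eq_add_of_sub_eq (hψ k).symm]
    exact Submodule.add_mem _ (Submodule.subset_span ⟨k, rfl⟩) (Submodule.sum_mem _ fun i _ =>
        Submodule.smul_mem _ _ (Submodule.subset_span ⟨i, rfl⟩))

/-- The image of a Schauder basis under a linear homeomorphism. -/
noncomputable def SchauderBasis.mapEquiv (b : SchauderBasis 𝕜 X) (T : X ≃L[𝕜] X) :
    SchauderBasis 𝕜 X where
  basis i := T (b i)
  coord i := (b.coord i).comp (T.symm : X →L[𝕜] X)
  ortho i j := by simpa using b.ortho i j
  expansion x := by
    simpa using (b.expansion (T.symm x)).mapL (T : X →L[𝕜] X)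

/-- If the functionals `φ k` lie in the closed span of the coordinate functionals of a Schauder
basis, then some Schauder basis has each `φ k` in the span of its coordinate functionals. -/
theorem SchauderBasis.exists_basis_annihilating [CompleteSpace X] (b : SchauderBasis 𝕜 X)
    (φ : ℕ → StrongDual 𝕜 X)
    (h : ∀ k, Tendsto (fun n => ‖φ k - (φ k).comp (b.proj n)‖) atTop (𝓝 0)) :
    ∃ b' : SchauderBasis 𝕜 X, ∀ k, ∃ n, ∀ x, (∀ i < n, b'.coord i x = 0) → φ k x = 0 := by
  obtain ⟨ψ, x, hne, heq, hψφ, hφψ⟩ := exists_biorthogonal φ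
  have hψ : ∀ k, Tendsto (fun n => ψ k - (ψ k).comp (b.proj n)) atTop (𝓝 0) := fun k => by
    refine Submodule.span_induction (p := fun χ _ =>
      Tendsto (fun n => χ - χ.comp (b.proj n)) atTop (𝓝 0)) ?_ ?_ ?_ ?_ (hψφ k)
    · rintro _ ⟨i, rfl⟩
      exact tendsto_zero_iff_norm_tendsto_zero.2 (h i)
    · simp
    · intro χ η _ _ h1 h2
      simpa [add_sub_add_comm] using h1.add h2
    · intro c χ _ h1
      rw [← smul_zero c]
      refine (h1.const_smul c).congr fun n => ?_
      ext z
      simp [mul_sub]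
  -- The uncontrolled size of `x k` is absorbed by going far enough along the basis. The bounds sum
  -- to `1 / 2`, so `1 - ∑ D k` is invertible by the Neumann series.
  have hex : ∀ k, ∃ n, ‖ψ k - (ψ k).comp (b.proj n)‖ * ‖x k‖ < (1 / 2) ^ (k + 1) / 2 := fun k => by
    have : Tendsto (fun n => ‖ψ k - (ψ k).comp (b.proj n)‖ * ‖x k‖) atTop (𝓝 0) := by
      simpa using ((hψ k).norm.mul_const ‖x k‖)
    exact (this.eventually (gt_mem_nhds (by positivity))).exists
  choose n hn using hex
  let ε : ℕ → StrongDual 𝕜 X := fun k => ψ k - (ψ k).comp (b.proj (n k))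
  let D : ℕ → X →L[𝕜] X := fun k => (ε k).smulRight (x k)
  have hDn : ∀ k, ‖D k‖ ≤ 1 / 2 / 2 * (1 / 2) ^ k := fun k => by
    rw [ContinuousLinearMap.norm_smulRight_apply]
    refine (hn k).le.trans (le_of_eq ?_)
    rw [pow_succ]
    ring
  have hgeo : HasSum (fun k : ℕ => (1 / 2 / 2 : ℝ) * (1 / 2) ^ k) (1 / 2 / 2 * 2) :=
    hasSum_geometric_two.mul_left _
  have hDs : Summable D := .of_norm_bounded hgeo.summable hDn
  have hDsum : ∀ z, HasSum (fun k => ε k z • x k) ((∑' k, D k) z) := fun z =>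
    hDs.hasSum.mapL (ContinuousLinearMap.apply 𝕜 X z)
  have hlt : ‖∑' k, D k‖ < 1 :=
    (tsum_of_norm_bounded hgeo hDn).trans_lt (by norm_num)
  let T : X ≃L[𝕜] X := ContinuousLinearEquiv.unitsEquiv 𝕜 X (Units.oneSub _ hlt)
  -- Biorthogonality leaves only the term `k = j`, so `ψ j ∘ T = ψ j - ε j`, which sees only the
  -- first `n j` coordinates.
  have hT : ∀ j z, ψ j (T z) = ψ j (b.proj (n j) z) := fun j z => by
    have e1 : T z = z - ∑' k, ε k z • x k := by
      change z - (∑' k, D k) z = _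
      rw [← (hDsum z).tsum_eq]
    have hs : Summable fun k => ε k z • x k := (hDsum z).summable
    rw [e1, map_sub, (ψ j).map_tsum hs, tsum_eq_single j]
    · rcases heq j with h1 | h1
      · simp [h1, ε]
      · simp [h1]
    · intro k hk
      simp [hne j k hk.symm]
  refine ⟨b.mapEquiv T, fun k => ?_⟩
  refine Submodule.span_induction (p := fun χ _ => ∃ n, ∀ z,
    (∀ i < n, (b.mapEquiv T).coord i z = 0) → χ z = 0) ?_ ?_ ?_ ?_ (hφψ k)
  · rintro _ ⟨j, rfl⟩
    refine ⟨n j, fun z hz => ?_⟩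
    have := hT j (T.symm z)
    rw [T.apply_symm_apply] at this
    rw [this, SchauderBasis.proj_apply, Finset.sum_eq_zero, map_zero]
    intro i hi
    have h0 : b.coord i (T.symm z) = 0 := hz i (Finset.mem_range.1 hi)
    rw [h0, zero_smul]
  · exact ⟨0, fun z _ => rfl⟩
  · rintro χ η _ _ ⟨n1, h1⟩ ⟨n2, h2⟩
    refine ⟨max n1 n2, fun z hz => ?_⟩
    rw [add_apply, h1 z fun i hi => hz i (lt_max_of_lt_left hi),
      h2 z fun i hi => hz i (lt_max_of_lt_right hi), add_zero]
  · rintro c χ _ ⟨n1, h1⟩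
    exact ⟨n1, fun z hz => by rw [smul_apply, h1 z hz, smul_zero]⟩

end Perturbation

/-! ### A binary tree of sets and the partitions it generates. -/

section SplitTree

variable {α : Type*} [MeasurableSpace α] (μ : Measure α) (S : ℕ → Set α)

/-- The least index `j` such that `S j` cuts `A` into two pieces of positive measure. -/
noncomputable def firstSplit (A : Set α) : ℕ := sInf {j | μ (A ∩ S j) ≠ 0 ∧ μ (A \ S j) ≠ 0}

/-- The binary tree of sets, numbered like a heap: the children of the `n`-th set are numbered
`2 * n` and `2 * n + 1`. -/
noncomputable def splitTree (n : ℕ) : Set α :=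
  if n ≤ 1 then Set.univ
  else if n % 2 = 0 then splitTree (n / 2) ∩ S (firstSplit μ S (splitTree (n / 2)))
  else splitTree (n / 2) \ S (firstSplit μ S (splitTree (n / 2)))
termination_by n
decreasing_by all_goals omega

theorem splitTree_one : splitTree μ S 1 = Set.univ := by rw [splitTree]; simp

theorem splitTree_two_mul {n : ℕ} (hn : 1 ≤ n) :
    splitTree μ S (2 * n) = splitTree μ S n ∩ S (firstSplit μ S (splitTree μ S n)) := by
  rw [splitTree, if_neg (by omega), if_pos (by omega), show 2 * n / 2 = n by omega]

theorem splitTree_two_mul_add_one {n : ℕ} (hn : 1 ≤ n) :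
    splitTree μ S (2 * n + 1) = splitTree μ S n \ S (firstSplit μ S (splitTree μ S n)) := by
  rw [splitTree, if_neg (by omega), if_neg (by omega), show (2 * n + 1) / 2 = n by omega]

/-- A sequence of sets of finite measure that splits every set of positive measure. -/
structure IsSplittingFamily : Prop where
  measurableSet : ∀ j, MeasurableSet (S j)
  measure_ne_top : ∀ j, μ (S j) ≠ ∞
  exists_split : ∀ A, MeasurableSet A → μ A ≠ 0 → ∃ j, μ (A ∩ S j) ≠ 0 ∧ μ (A \ S j) ≠ 0
  measure_univ : μ Set.univ = ∞

variable {μ S}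

theorem splitTree_union {n : ℕ} (hn : 1 ≤ n) :
    splitTree μ S (2 * n) ∪ splitTree μ S (2 * n + 1) = splitTree μ S n := by
  rw [splitTree_two_mul μ S hn, splitTree_two_mul_add_one μ S hn, Set.inter_union_sdiff]

theorem splitTree_two_mul_subset {n : ℕ} (hn : 1 ≤ n) :
    splitTree μ S (2 * n) ⊆ splitTree μ S n := by
  rw [splitTree_two_mul μ S hn]; exact Set.inter_subset_left

theorem splitTree_two_mul_add_one_subset {n : ℕ} (hn : 1 ≤ n) :
    splitTree μ S (2 * n + 1) ⊆ splitTree μ S n := by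
  rw [splitTree_two_mul_add_one μ S hn]; exact Set.sdiff_subset

theorem splitTree_disjoint_children {n : ℕ} (hn : 1 ≤ n) :
    Disjoint (splitTree μ S (2 * n)) (splitTree μ S (2 * n + 1)) := by
  rw [splitTree_two_mul μ S hn, splitTree_two_mul_add_one μ S hn]
  exact Set.disjoint_sdiff_right.mono_left Set.inter_subset_right

/-- The `n`-th partition consists of the sets numbered `n, ..., 2 * n - 1`. Passing to the next one
removes the set `n` and adds its two children. -/
theorem mem_Ico_succ_two_mul {n k : ℕ} (hk : k ∈ Finset.Ico (n + 1) (2 * (n + 1))) :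
    (k ∈ Finset.Ico n (2 * n) ∧ k ≠ n) ∨ k = 2 * n ∨ k = 2 * n + 1 := by
  simp only [Finset.mem_Ico] at hk ⊢
  omega

theorem splitTree_pairwiseDisjoint {n : ℕ} (hn : 1 ≤ n) :
    Set.PairwiseDisjoint (Finset.Ico n (2 * n) : Set ℕ) (splitTree μ S) := by
  induction n, hn using Nat.le_induction with
  | base =>
    intro i hi j hj hij
    simp only [Finset.coe_Ico, Set.mem_Ico] at hi hj
    omega
  | succ n hn ih =>
    have old : ∀ k ∈ Finset.Ico n (2 * n), k ≠ n → Disjoint (splitTree μ S n) (splitTree μ S k) :=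
      fun k hk hkn => ih (Finset.mem_Ico.2 ⟨le_rfl, by omega⟩) hk hkn.symm
    intro i hi j hj hij
    rcases mem_Ico_succ_two_mul hi with ⟨hi, hin⟩ | rfl | rfl <;>
    rcases mem_Ico_succ_two_mul hj with ⟨hj, hjn⟩ | rfl | rfl
    · exact ih hi hj hij
    · exact ((old i hi hin).mono_left (splitTree_two_mul_subset hn)).symm
    · exact ((old i hi hin).mono_left (splitTree_two_mul_add_one_subset hn)).symm
    · exact (old j hj hjn).mono_left (splitTree_two_mul_subset hn)
    · exact absurd rfl hij
    · exact splitTree_disjoint_children hn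
    · exact (old j hj hjn).mono_left (splitTree_two_mul_add_one_subset hn)
    · exact (splitTree_disjoint_children hn).symm
    · exact absurd rfl hij

theorem splitTree_biUnion {n : ℕ} (hn : 1 ≤ n) :
    ⋃ k ∈ Finset.Ico n (2 * n), splitTree μ S k = Set.univ := by
  induction n, hn using Nat.le_induction with
  | base => simp [splitTree_one]
  | succ n hn ih =>
    refine Set.eq_univ_of_forall fun x => ?_
    have hx : x ∈ ⋃ k ∈ Finset.Ico n (2 * n), splitTree μ S k := ih ▸ Set.mem_univ x
    simp only [Set.mem_iUnion, Finset.mem_Ico] at hx ⊢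
    obtain ⟨k, hk, hxk⟩ := hx
    rcases eq_or_ne k n with rfl | hkn
    · rw [← splitTree_union hn] at hxk
      rcases hxk with h | h
      · exact ⟨2 * k, by omega, h⟩
      · exact ⟨2 * k + 1, by omega, h⟩
    · exact ⟨k, by omega, hxk⟩

/-- The bound `k < 2 * j` prevents `k` from being a proper descendant of `j`. If `j < k`, both sets
belong to the `j`-th partition; otherwise the `j`-th partition refines the `k`-th. -/
theorem splitTree_subset_or_disjoint {k j : ℕ} (hk : 1 ≤ k) (hj : 1 ≤ j) (h : k < 2 * j) :
    splitTree μ S j ⊆ splitTree μ S k ∨ Disjoint (splitTree μ S j) (splitTree μ S k) := by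
  rcases lt_or_ge j k with hjk | hkj
  · exact Or.inr (splitTree_pairwiseDisjoint hj (by simp; omega) (by simp; omega) hjk.ne)
  · suffices ∀ n, k ≤ n → ∀ j ∈ Finset.Ico n (2 * n), splitTree μ S j ⊆ splitTree μ S k ∨
        Disjoint (splitTree μ S j) (splitTree μ S k) from
      this j hkj j (Finset.mem_Ico.2 ⟨le_rfl, by omega⟩)
    intro n hn
    induction n, hn using Nat.le_induction with
    | base =>
      intro j hj
      rcases eq_or_ne j k with rfl | hne
      · exact Or.inl le_rfl
      · exact Or.inr (splitTree_pairwiseDisjoint hk hj (by simp; omega) hne)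
    | succ n hn ih =>
      intro j hj
      have hnn := ih n (Finset.mem_Ico.2 ⟨le_rfl, by omega⟩)
      rcases mem_Ico_succ_two_mul hj with ⟨hj, -⟩ | rfl | rfl
      · exact ih j hj
      · have := splitTree_two_mul_subset (μ := μ) (S := S) (hk.trans hn)
        exact hnn.imp this.trans (Disjoint.mono_left this)
      · have := splitTree_two_mul_add_one_subset (μ := μ) (S := S) (hk.trans hn)
        exact hnn.imp this.trans (Disjoint.mono_left this)

theorem firstSplit_le_of_pos {A : Set α} {j : ℕ} (h1 : μ (A ∩ S j) ≠ 0) (h2 : μ (A \ S j) ≠ 0) :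
    firstSplit μ S A ≤ j := Nat.sInf_le ⟨h1, h2⟩

namespace IsSplittingFamily

variable (hS : IsSplittingFamily μ S)
include hS

theorem measurableSet_splitTree (n : ℕ) : MeasurableSet (splitTree μ S n) := by
  induction n using Nat.strong_induction_on with
  | _ n ih =>
    rw [splitTree]
    split_ifs with h1 h2
    · exact MeasurableSet.univ
    · exact (ih _ (by omega)).inter (hS.measurableSet _)
    · exact (ih _ (by omega)).diff (hS.measurableSet _)

theorem firstSplit_spec {A : Set α} (hA : MeasurableSet A) (h : μ A ≠ 0) :
    μ (A ∩ S (firstSplit μ S A)) ≠ 0 ∧ μ (A \ S (firstSplit μ S A)) ≠ 0 :=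
  Nat.sInf_mem (hS.exists_split A hA h)

theorem measure_splitTree_ne_zero (n : ℕ) : μ (splitTree μ S n) ≠ 0 := by
  induction n using Nat.strong_induction_on with
  | _ n ih =>
    rw [splitTree]
    split_ifs with h1 h2
    · simp [hS.measure_univ]
    · exact (hS.firstSplit_spec (hS.measurableSet_splitTree _) (ih _ (by omega))).1
    · exact (hS.firstSplit_spec (hS.measurableSet_splitTree _) (ih _ (by omega))).2

theorem measure_splitTree_two_mul {n : ℕ} (hn : 1 ≤ n) : μ (splitTree μ S (2 * n)) ≠ ∞ := by
  rw [splitTree_two_mul μ S hn]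
  exact measure_ne_top_of_subset Set.inter_subset_right (hS.measure_ne_top _)

/-- An even child lies in some `S j` and is finite, so infinite measure is inherited by the odd
child. Each partition thus has exactly one infinite piece, along the branch `1, 3, 7, ...`. -/
theorem measure_splitTree_two_mul_add_one {n : ℕ} (hn : 1 ≤ n) :
    μ (splitTree μ S (2 * n + 1)) = ∞ ↔ μ (splitTree μ S n) = ∞ := by
  rw [← splitTree_union (n := n) hn, measure_union (splitTree_disjoint_children hn)
    (hS.measurableSet_splitTree _), ENNReal.add_eq_top]
  simp [hS.measure_splitTree_two_mul hn]

/-- An index that splits the child also splits the parent, while the set that cut the parent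
contains the child or misses it. Hence the splitting index grows with the depth, and each `S j`
eventually splits no piece. -/
theorem firstSplit_lt {n : ℕ} (hn : 1 ≤ n) {k : ℕ} (hk : k / 2 = n) :
    firstSplit μ S (splitTree μ S n) < firstSplit μ S (splitTree μ S k) := by
  have hs := hS.firstSplit_spec (hS.measurableSet_splitTree k) (hS.measure_splitTree_ne_zero k)
  have hsub : splitTree μ S k ⊆ splitTree μ S n := by
    rcases (show k = 2 * n ∨ k = 2 * n + 1 by omega) with rfl | rfl
    · exact splitTree_two_mul_subset hn
    · exact splitTree_two_mul_add_one_subset hn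
  refine lt_of_le_of_ne (firstSplit_le_of_pos
    (fun h => hs.1 (measure_mono_null (Set.inter_subset_inter_left _ hsub) h))
    (fun h => hs.2 (measure_mono_null (Set.sdiff_subset_sdiff_left hsub) h))) fun he => ?_
  rw [← he] at hs
  rcases (show k = 2 * n ∨ k = 2 * n + 1 by omega) with rfl | rfl
  · refine hs.2 ?_
    rw [splitTree_two_mul μ S hn, Set.sdiff_eq_empty.2 Set.inter_subset_right, measure_empty]
  · refine hs.1 ?_
    rw [splitTree_two_mul_add_one μ S hn, Set.sdiff_inter_self, measure_empty]

theorem le_firstSplit (J : ℕ) : ∀ k, 2 ^ J ≤ k → J ≤ firstSplit μ S (splitTree μ S k) := by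
  induction J with
  | zero => simp
  | succ J ih =>
    intro k hk
    rw [pow_succ] at hk
    have h2 : 2 ^ J ≤ k / 2 := by omega
    exact (ih _ h2).trans_lt (hS.firstSplit_lt (Nat.one_le_two_pow.trans h2) rfl)

theorem measure_eq_zero_of_large {J k j : ℕ} (hk : 2 ^ J ≤ k) (hj : j < J) :
    μ (splitTree μ S k ∩ S j) = 0 ∨ μ (splitTree μ S k \ S j) = 0 := by
  by_contra! h
  exact absurd (firstSplit_le_of_pos h.1 h.2) (by have := hS.le_firstSplit J k hk; omega)

/-- Pieces far down the tree are small near a compact set, in the sense that a given continuous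
function has small oscillation on them. -/
theorem eventually_small_osc [TopologicalSpace α] {F : Type*} [NormedAddCommGroup F]
    (hbasis : ∀ x, ∀ U, IsOpen U → x ∈ U → ∃ j, x ∈ S j ∧ S j ⊆ U) (hopen : ∀ j, IsOpen (S j))
    {g : α → F} (hg : Continuous g) {K V : Set α} (hK : IsCompact K) (hV : IsOpen V)
    (hKV : K ⊆ V) {η : ℝ} (hη : 0 < η) :
    ∃ n₀, ∀ k, n₀ ≤ k → (∀ᵐ x ∂μ.restrict (splitTree μ S k), x ∉ K) ∨
      ∃ c, ∀ᵐ x ∂μ.restrict (splitTree μ S k), x ∈ V ∧ ‖g x - c‖ ≤ η := by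
  have h1 : ∀ x ∈ K, ∃ j, x ∈ S j ∧ S j ⊆ V ∩ g ⁻¹' Metric.ball (g x) η := fun x hx =>
    hbasis x _ (hV.inter (Metric.isOpen_ball.preimage hg))
      ⟨hKV hx, Metric.mem_ball_self hη⟩
  choose! j hj using h1
  obtain ⟨t, htK, ht⟩ := hK.elim_nhds_subcover (fun x => S (j x))
    fun x hx => (hopen _).mem_nhds (hj x hx).1
  -- From this depth on, none of the finitely many sets covering `K` splits a piece. A piece is
  -- almost contained in one of them, where `g` is nearly constant, or almost misses all of them and
  -- hence `K`.
  refine ⟨2 ^ (t.sup j + 1), fun k hk => ?_⟩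
  by_cases hex : ∃ x ∈ t, μ (splitTree μ S k \ S (j x)) = 0
  · obtain ⟨x, hx, h0⟩ := hex
    refine Or.inr ⟨g x, ?_⟩
    rw [ae_restrict_iff' (hS.measurableSet_splitTree k)]
    refine measure_mono_null ?_ h0
    intro y hy
    simp only [Set.mem_compl_iff, Set.mem_ofPred_eq, Classical.not_imp] at hy
    refine ⟨hy.1, fun hyS => hy.2 ?_⟩
    have := (hj x (htK x hx)).2 hyS
    exact ⟨this.1, (mem_ball_iff_norm.1 this.2).le⟩
  · push Not at hex
    left
    rw [ae_restrict_iff' (hS.measurableSet_splitTree k)]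
    have h0 : μ (⋃ x ∈ t, splitTree μ S k ∩ S (j x)) = 0 := by
      refine (measure_biUnion_null_iff t.countable_toSet).2 ?_
      intro x hx
      exact (hS.measure_eq_zero_of_large hk
        (Nat.lt_succ_of_le (Finset.le_sup hx))).resolve_right (hex x hx)
    refine measure_mono_null ?_ h0
    intro y hy
    simp only [Set.mem_compl_iff, Set.mem_ofPred_eq, Classical.not_imp, not_not] at hy
    have := ht hy.2
    simp only [Set.mem_iUnion] at this ⊢
    obtain ⟨x, hx, hyx⟩ := this
    exact ⟨x, hx, hy.1, hyx⟩

end IsSplittingFamily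

/-- A locally finite infinite measure without atoms on a second countable space is split by a
countable basis of the topology. -/
theorem exists_isSplittingFamily [TopologicalSpace α] [SecondCountableTopology α] [T1Space α]
    [BorelSpace α] (μ : Measure α) [IsLocallyFiniteMeasure μ] [NullSingletonClass μ]
    (huniv : μ Set.univ = ∞) :
    ∃ S : ℕ → Set α, IsSplittingFamily μ S ∧ (∀ j, IsOpen (S j)) ∧
      ∀ x, ∀ U, IsOpen U → x ∈ U → ∃ j, x ∈ S j ∧ S j ⊆ U := by
  classical
  have hne : (TopologicalSpace.countableBasis α).Nonempty := by
    by_contra hc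
    have h := (TopologicalSpace.isBasis_countableBasis α).sUnion_eq
    rw [Set.not_nonempty_iff_eq_empty.1 hc, Set.sUnion_empty] at h
    rw [← h, measure_empty] at huniv
    exact ENNReal.zero_ne_top huniv
  obtain ⟨u, hu⟩ := (TopologicalSpace.countable_countableBasis α).exists_eq_range hne
  have huo : ∀ j, IsOpen (u j) := fun j =>
    (TopologicalSpace.isBasis_countableBasis α).isOpen (hu ▸ ⟨j, rfl⟩)
  -- Discarding basic sets of infinite measure keeps a basis, because the measure is locally finite.
  let S : ℕ → Set α := fun j => if μ (u j) = ∞ then ∅ else u j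
  have hopen : ∀ j, IsOpen (S j) := fun j => by
    simp only [S]; split_ifs
    · exact isOpen_empty
    · exact huo j
  have hbasis : ∀ x, ∀ U, IsOpen U → x ∈ U → ∃ j, x ∈ S j ∧ S j ⊆ U := by
    intro x U hU hx
    obtain ⟨W, hxW, hW, hWfin⟩ := μ.exists_isOpen_measure_lt_top x
    obtain ⟨v, hv, hxv, hvU⟩ := (TopologicalSpace.isBasis_countableBasis α).exists_subset_of_mem_open
      (⟨hx, hxW⟩ : x ∈ U ∩ W) (hU.inter hW)
    rw [hu] at hv
    obtain ⟨j, rfl⟩ := hv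
    have : μ (u j) ≠ ∞ := ((measure_mono (hvU.trans Set.inter_subset_right)).trans_lt hWfin).ne
    refine ⟨j, ?_⟩
    simp only [S, if_neg this]
    exact ⟨hxv, hvU.trans Set.inter_subset_left⟩
  refine ⟨S, ⟨fun j => (hopen j).measurableSet, fun j => ?_, fun A hA h => ?_, huniv⟩, hopen,
    hbasis⟩
  · simp only [S]; split_ifs with h
    · simp
    · exact h
  -- If nothing splits `A`, choose `x` in `A` outside every `S j` that meets `A` in a null set. Each
  -- `S j` containing `x` then contains almost all of `A`, and these sets intersect in `{x}`, so `A`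
  -- would be null.
  · by_contra! hc
    have hU : μ (⋃ j ∈ {j | μ (A ∩ S j) = 0}, A ∩ S j) = 0 :=
      (measure_biUnion_null_iff (Set.to_countable _)).2 fun j hj => hj
    obtain ⟨x, hxA, hx⟩ : ∃ x ∈ A, x ∉ ⋃ j ∈ {j | μ (A ∩ S j) = 0}, A ∩ S j := by
      by_contra! hcon
      exact h (measure_mono_null hcon hU)
    have h2 : ∀ j, x ∈ S j → μ (A \ S j) = 0 := fun j hj => hc j fun h0 =>
      hx (Set.mem_biUnion (show j ∈ {j | μ (A ∩ S j) = 0} from h0) ⟨hxA, hj⟩)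
    have h3 : μ (⋃ j ∈ {j | x ∈ S j}, A \ S j) = 0 :=
      (measure_biUnion_null_iff (Set.to_countable _)).2 h2
    refine h (measure_mono_null (t := (⋃ j ∈ {j | x ∈ S j}, A \ S j) ∪ {x}) ?_
      (measure_union_null h3 (measure_singleton x)))
    intro y hy
    by_cases hxy : y = x
    · exact Or.inr hxy
    · left
      obtain ⟨j, hxj, hj⟩ := hbasis x {y}ᶜ isOpen_compl_singleton fun h => hxy h.symm
      exact Set.mem_biUnion (show j ∈ {j | x ∈ S j} from hxj) ⟨hy, fun h => hj h rfl⟩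

end SplitTree

/-! ### Integrals, indicators and averages over sets in `Lp`. -/

section HaarBasis

variable {α : Type*} [MeasurableSpace α] {μ : Measure α} {𝕜 : Type*} [RCLike 𝕜]
  {p : ℝ≥0∞} [hp1 : Fact (1 ≤ p)]

theorem Lp.integrableOn_of_measure_ne_top (f : Lp 𝕜 p μ) {A : Set α} (hA : μ A ≠ ∞) :
    IntegrableOn f A μ := by
  have : IsFiniteMeasure (μ.restrict A) := ⟨by simpa using hA.lt_top⟩
  exact ((Lp.memLp f).restrict A).integrable hp1.out

theorem Lp.exists_integral_norm_le (μ : Measure α) (𝕜 : Type*) [RCLike 𝕜] (p : ℝ≥0∞)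
    [hp1 : Fact (1 ≤ p)] {A : Set α} (hA : μ A ≠ ∞) :
    ∃ C, 0 ≤ C ∧ ∀ f : Lp 𝕜 p μ, ∫ x in A, ‖f x‖ ∂μ ≤ C * ‖f‖ := by
  refine ⟨((μ A) ^ (1 / (1 : ℝ≥0∞).toReal - 1 / p.toReal)).toReal, by positivity, fun f => ?_⟩
  have h := eLpNorm_le_eLpNorm_mul_rpow_measure_univ hp1.out
    ((Lp.aestronglyMeasurable f).restrict (s := A))
  rw [Measure.restrict_apply_univ] at h
  have hpow : μ A ^ (1 / (1 : ℝ≥0∞).toReal - 1 / p.toReal) ≠ ∞ := by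
    refine ENNReal.rpow_ne_top_of_nonneg ?_ hA
    have : 1 / p.toReal ≤ 1 := by
      rcases eq_or_ne p ∞ with rfl | hp
      · simp
      · have : 1 ≤ p.toReal := by
          simpa using ENNReal.toReal_mono hp hp1.out
        exact (div_le_one (by linarith)).2 this
    simpa using this
  rw [integral_norm_eq_lintegral_enorm (Lp.aestronglyMeasurable f).restrict,
    ← eLpNorm_one_eq_lintegral_enorm, mul_comm, Lp.norm_def, ← ENNReal.toReal_mul]
  refine ENNReal.toReal_mono (ENNReal.mul_ne_top (Lp.eLpNorm_ne_top f) hpow) (h.trans ?_)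
  gcongr
  exact Measure.restrict_le_self

variable (μ 𝕜 p)

open Classical in
/-- The integral over a set of finite measure as a functional on `Lp`. -/
noncomputable def setIntegralDual (A : Set α) : StrongDual 𝕜 (Lp 𝕜 p μ) :=
  if hA : μ A ≠ ∞ then
    LinearMap.mkContinuousOfExistsBound
      { toFun := fun f => ∫ x in A, f x ∂μ
        map_add' := fun f g => by
          rw [← integral_add (Lp.integrableOn_of_measure_ne_top f hA)
            (Lp.integrableOn_of_measure_ne_top g hA)]
          exact integral_congr_ae (ae_restrict_of_ae (Lp.coeFn_add f g))
        map_smul' := fun c f => by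
          rw [RingHom.id_apply, ← integral_smul]
          exact integral_congr_ae (ae_restrict_of_ae (Lp.coeFn_smul c f)) } (by
        obtain ⟨C, -, hC⟩ := Lp.exists_integral_norm_le μ 𝕜 p hA
        exact ⟨C, fun f => (norm_integral_le_integral_norm _).trans (hC f)⟩)
  -- With this default the average over a set of infinite measure is zero, so the infinite piece of
  -- each partition needs no separate treatment in the sums.
  else 0

open Classical in
/-- The indicator function of a set of finite measure as an element of `Lp`. -/
noncomputable def indicatorVec (A : Set α) : Lp 𝕜 p μ :=
  if h : MeasurableSet A ∧ μ A ≠ ∞ then indicatorConstLp p h.1 h.2 1 else 0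

/-- The average over a set, times the indicator function of this set. -/
noncomputable def averageVec (A : Set α) (f : Lp 𝕜 p μ) : Lp 𝕜 p μ :=
  ((μ.real A : 𝕜)⁻¹ * setIntegralDual μ 𝕜 p A f) • indicatorVec μ 𝕜 p A

variable {μ 𝕜 p} {A B : Set α}

theorem setIntegralDual_apply (hA : μ A ≠ ∞) (f : Lp 𝕜 p μ) :
    setIntegralDual μ 𝕜 p A f = ∫ x in A, f x ∂μ := by
  rw [setIntegralDual, dif_pos hA]
  rfl

theorem setIntegralDual_of_top (hA : μ A = ∞) : setIntegralDual μ 𝕜 p A = 0 := by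
  rw [setIntegralDual, dif_neg (not_not.2 hA)]

omit hp1 in
theorem indicatorVec_of_top (hA : μ A = ∞) : indicatorVec μ 𝕜 p A = 0 := by
  rw [indicatorVec, dif_neg (fun h => h.2 hA)]

omit hp1 in
theorem coeFn_indicatorVec (hA : MeasurableSet A) (h : μ A ≠ ∞) :
    indicatorVec μ 𝕜 p A =ᵐ[μ] A.indicator fun _ => 1 := by
  rw [indicatorVec, dif_pos ⟨hA, h⟩]
  exact indicatorConstLp_coeFn

theorem setIntegralDual_indicatorVec (hB : MeasurableSet B)
    (h : μ A ≠ ∞) (h' : μ B ≠ ∞) :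
    setIntegralDual μ 𝕜 p A (indicatorVec μ 𝕜 p B) = (μ.real (A ∩ B) : 𝕜) := by
  rw [setIntegralDual_apply h, integral_congr_ae (ae_restrict_of_ae (coeFn_indicatorVec hB h')),
    integral_indicator_const _ hB, measureReal_restrict_apply hB, Set.inter_comm,
    RCLike.real_smul_eq_coe_mul, mul_one]

theorem setIntegralDual_indicatorVec_comm (hA : MeasurableSet A) (hB : MeasurableSet B) :
    setIntegralDual μ 𝕜 p A (indicatorVec μ 𝕜 p B) =
      setIntegralDual μ 𝕜 p B (indicatorVec μ 𝕜 p A) := by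
  by_cases h : μ A = ∞
  · simp [setIntegralDual_of_top h, indicatorVec_of_top h]
  by_cases h' : μ B = ∞
  · simp [setIntegralDual_of_top h', indicatorVec_of_top h']
  rw [setIntegralDual_indicatorVec hB h h', setIntegralDual_indicatorVec hA h' h,
    Set.inter_comm]

theorem setIntegralDual_union (hB : MeasurableSet B) (hAB : Disjoint A B)
    (h : μ A ≠ ∞) (h' : μ B ≠ ∞) :
    setIntegralDual μ 𝕜 p (A ∪ B) = setIntegralDual μ 𝕜 p A + setIntegralDual μ 𝕜 p B := by
  ext f
  rw [add_apply, setIntegralDual_apply h, setIntegralDual_apply h',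
    setIntegralDual_apply (measure_union_ne_top h h'),
    setIntegral_union hAB hB (Lp.integrableOn_of_measure_ne_top f h)
      (Lp.integrableOn_of_measure_ne_top f h')]

omit hp1 in
theorem indicatorVec_union (hA : MeasurableSet A) (hB : MeasurableSet B) (hAB : Disjoint A B)
    (h : μ A ≠ ∞) (h' : μ B ≠ ∞) :
    indicatorVec μ 𝕜 p (A ∪ B) = indicatorVec μ 𝕜 p A + indicatorVec μ 𝕜 p B := by
  refine Lp.ext ?_
  filter_upwards [coeFn_indicatorVec (𝕜 := 𝕜) (p := p) (hA.union hB) (measure_union_ne_top h h'),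
    coeFn_indicatorVec (𝕜 := 𝕜) (p := p) hA h, coeFn_indicatorVec (𝕜 := 𝕜) (p := p) hB h',
    Lp.coeFn_add (indicatorVec μ 𝕜 p A) (indicatorVec μ 𝕜 p B)] with x h1 h2 h3 h4
  rw [h1, h4, Pi.add_apply, h2, h3, Set.indicator_union_of_disjoint hAB]

theorem averageVec_of_top (hA : μ A = ∞) (f : Lp 𝕜 p μ) : averageVec μ 𝕜 p A f = 0 := by
  rw [averageVec, indicatorVec_of_top hA, smul_zero]

theorem coeFn_averageVec (hA : MeasurableSet A) (f : Lp 𝕜 p μ) :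
    averageVec μ 𝕜 p A f =ᵐ[μ]
      A.indicator fun _ => (μ.real A : 𝕜)⁻¹ * setIntegralDual μ 𝕜 p A f := by
  by_cases h : μ A = ∞
  · rw [averageVec_of_top h]
    filter_upwards [Lp.coeFn_zero 𝕜 p μ] with x hx
    refine hx.trans ?_
    simp [setIntegralDual_of_top h]
  · filter_upwards [Lp.coeFn_smul ((μ.real A : 𝕜)⁻¹ * setIntegralDual μ 𝕜 p A f)
      (indicatorVec μ 𝕜 p A), coeFn_indicatorVec (𝕜 := 𝕜) (p := p) hA h] with x h1 h2
    rw [averageVec, h1, Pi.smul_apply, h2]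
    by_cases hx : x ∈ A <;> simp [hx]

/-- Jensen's inequality for the average over a set. -/
theorem lintegral_average_rpow_le (hp : p ≠ ∞) (f : Lp 𝕜 p μ) :
    ∫⁻ _ in A, ‖(μ.real A : 𝕜)⁻¹ * setIntegralDual μ 𝕜 p A f‖ₑ ^ p.toReal ∂μ ≤
      ∫⁻ x in A, ‖f x‖ₑ ^ p.toReal ∂μ := by
  have hp0 : 1 ≤ p.toReal := by simpa using ENNReal.toReal_mono hp hp1.out
  by_cases h : μ A = ∞
  · simp [setIntegralDual_of_top h, ENNReal.zero_rpow_of_pos (zero_lt_one.trans_le hp0)]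
  by_cases h0 : μ A = 0
  · simp [Measure.restrict_eq_zero.2 h0]
  have h1 := eLpNorm_le_eLpNorm_mul_rpow_measure_univ hp1.out
    ((Lp.aestronglyMeasurable f).restrict (s := A))
  rw [eLpNorm_one_eq_lintegral_enorm, Measure.restrict_apply_univ,
    eLpNorm_eq_lintegral_rpow_enorm_toReal (zero_lt_one.trans_le hp1.out).ne' hp] at h1
  have h2 : ‖∫ x in A, f x ∂μ‖ₑ ≤ _ := (enorm_integral_le_lintegral_enorm _).trans h1
  have h3 := ENNReal.rpow_le_rpow h2 (zero_le_one.trans hp0)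
  rw [ENNReal.mul_rpow_of_nonneg _ _ (zero_le_one.trans hp0), ← ENNReal.rpow_mul,
    one_div_mul_cancel (by linarith), ENNReal.rpow_one, ← ENNReal.rpow_mul] at h3
  rw [lintegral_const, Measure.restrict_apply_univ, setIntegralDual_apply h, enorm_mul,
    ENNReal.mul_rpow_of_nonneg _ _ (zero_le_one.trans hp0)]
  have h4 : ‖(μ.real A : 𝕜)⁻¹‖ₑ = (μ A)⁻¹ := by
    have hr : μ.real A ≠ 0 := by simp [Measure.real, ENNReal.toReal_eq_zero_iff, h, h0]
    rw [enorm_inv (by simpa using hr), ← ofReal_norm, RCLike.norm_ofReal,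
      abs_of_nonneg measureReal_nonneg, ofReal_measureReal h]
  rw [h4, mul_comm _ (μ A), ← mul_assoc]
  -- The average contributes `μ A` to the power `1 - p` and Hölder contributes the power `p - 1`;
  -- they cancel.
  calc _ ≤ μ A * (μ A)⁻¹ ^ p.toReal * ((∫⁻ x in A, ‖f x‖ₑ ^ p.toReal ∂μ) *
        μ A ^ ((1 / (1 : ℝ≥0∞).toReal - 1 / p.toReal) * p.toReal)) := by gcongr
    _ = (μ A * (μ A)⁻¹ ^ p.toReal * μ A ^ ((1 / (1 : ℝ≥0∞).toReal - 1 / p.toReal) * p.toReal)) *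
        ∫⁻ x in A, ‖f x‖ₑ ^ p.toReal ∂μ := by ring
    _ = 1 * ∫⁻ x in A, ‖f x‖ₑ ^ p.toReal ∂μ := by
      congr 1
      have e : (1 / (1 : ℝ≥0∞).toReal - 1 / p.toReal) * p.toReal = p.toReal - 1 := by
        rw [sub_mul, one_div_mul_cancel (by linarith)]; simp
      rw [e, ENNReal.inv_rpow, ← ENNReal.rpow_neg]
      nth_rewrite 1 [← ENNReal.rpow_one (μ A)]
      rw [← ENNReal.rpow_add _ _ h0 h, ← ENNReal.rpow_add _ _ h0 h]
      rw [show 1 + -p.toReal + (p.toReal - 1) = 0 by ring, ENNReal.rpow_zero]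
    _ = _ := one_mul _

end HaarBasis

/-! ### The Haar system: biorthogonality, telescoping and contractivity. -/

section HaarBasis

variable {α : Type*} [MeasurableSpace α] {μ : Measure α} {𝕜 : Type*} [RCLike 𝕜]
  {p : ℝ≥0∞} [hp1 : Fact (1 ≤ p)]

omit hp1 in
theorem Lp.coeFn_sum_apply {ι : Type*} (s : Finset ι) (u : ι → Lp 𝕜 p μ) :
    ∀ᵐ x ∂μ, (∑ i ∈ s, u i : Lp 𝕜 p μ) x = ∑ i ∈ s, u i x := by
  classical
  induction s using Finset.induction_on with
  | empty =>
    filter_upwards [Lp.coeFn_zero 𝕜 p μ] with x hx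
    simpa using hx
  | insert i s hi ih =>
    filter_upwards [ih, Lp.coeFn_add (u i) (∑ i ∈ s, u i)] with x h1 h2
    rw [Finset.sum_insert hi, h2, Pi.add_apply, h1, Finset.sum_insert hi]

variable (μ 𝕜 p) (S : ℕ → Set α)

/-- The Haar functional: the difference of the averages over the children of the `n`-th set. -/
noncomputable def haarDual (n : ℕ) : StrongDual 𝕜 (Lp 𝕜 p μ) :=
  (μ.real (splitTree μ S (2 * n)) : 𝕜)⁻¹ • setIntegralDual μ 𝕜 p (splitTree μ S (2 * n)) -
    (μ.real (splitTree μ S (2 * n + 1)) : 𝕜)⁻¹ • setIntegralDual μ 𝕜 p (splitTree μ S (2 * n + 1))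

/-- The Haar function of the `n`-th set. -/
noncomputable def haarVec (n : ℕ) : Lp 𝕜 p μ :=
  (μ.real (splitTree μ S (2 * n)) : 𝕜)⁻¹ • indicatorVec μ 𝕜 p (splitTree μ S (2 * n)) -
    (μ.real (splitTree μ S (2 * n + 1)) : 𝕜)⁻¹ • indicatorVec μ 𝕜 p (splitTree μ S (2 * n + 1))

/-- The normalisation constant of the Haar functional. -/
noncomputable def haarConst (n : ℕ) : 𝕜 :=
  ((μ.real (splitTree μ S (2 * n)) : 𝕜)⁻¹ + (μ.real (splitTree μ S (2 * n + 1)) : 𝕜)⁻¹)⁻¹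

/-- The averaging projection of the `n`-th partition of the tree. -/
noncomputable def treeProj (n : ℕ) (f : Lp 𝕜 p μ) : Lp 𝕜 p μ :=
  ∑ k ∈ Finset.Ico n (2 * n), averageVec μ 𝕜 p (splitTree μ S k) f

variable {μ 𝕜 p S}

namespace IsSplittingFamily

variable (hS : IsSplittingFamily μ S)
include hS

theorem coe_measureReal_ne_zero {n : ℕ} (h : μ (splitTree μ S n) ≠ ∞) :
    (μ.real (splitTree μ S n) : 𝕜) ≠ 0 := by
  simp [Measure.real, ENNReal.toReal_eq_zero_iff, h, hS.measure_splitTree_ne_zero]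

/-- Refining one set of the partition changes the averaging operator by a rank one term. If the
parent is infinite, so is the odd child; both averages vanish and the Haar term is the average over
the even child. -/
theorem averageVec_children {n : ℕ} (hn : 1 ≤ n) (f : Lp 𝕜 p μ) :
    averageVec μ 𝕜 p (splitTree μ S (2 * n)) f + averageVec μ 𝕜 p (splitTree μ S (2 * n + 1)) f =
      averageVec μ 𝕜 p (splitTree μ S n) f +
        (haarConst μ 𝕜 S n * haarDual μ 𝕜 p S n f) • haarVec μ 𝕜 p S n := by
  have h0 := hS.measure_splitTree_two_mul hn
  have hx := hS.coe_measureReal_ne_zero (𝕜 := 𝕜) h0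
  by_cases h : μ (splitTree μ S n) = ∞
  · have h1 := (hS.measure_splitTree_two_mul_add_one hn).2 h
    rw [averageVec_of_top h1, averageVec_of_top h, averageVec, haarConst, haarVec, haarDual,
      indicatorVec_of_top h1, sub_apply, smul_apply, smul_apply, setIntegralDual_of_top h1]
    simp only [measureReal_def, h1, ENNReal.toReal_top] at hx ⊢
    simp only [RCLike.ofReal_zero, inv_zero, zero_smul, sub_zero, add_zero, inv_inv, zero_add,
      zero_apply, smul_eq_mul, smul_smul]
    congr 1
    field_simp
    simp
  · have h1 : μ (splitTree μ S (2 * n + 1)) ≠ ∞ := fun h1 =>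
      h ((hS.measure_splitTree_two_mul_add_one hn).1 h1)
    have hy := hS.coe_measureReal_ne_zero (𝕜 := 𝕜) h1
    have hxy := hS.coe_measureReal_ne_zero (𝕜 := 𝕜) h
    have hd := splitTree_disjoint_children (μ := μ) (S := S) hn
    have hm := hS.measurableSet_splitTree
    have hreal : (μ.real (splitTree μ S n) : 𝕜) =
        μ.real (splitTree μ S (2 * n)) + μ.real (splitTree μ S (2 * n + 1)) := by
      rw [← splitTree_union hn, measureReal_union hd (hm _) h0 h1, RCLike.ofReal_add]
    rw [averageVec, averageVec, averageVec, haarConst, haarVec, haarDual, hreal]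
    rw [hreal] at hxy
    rw [← splitTree_union (n := n) hn, setIntegralDual_union (hm _) hd h0 h1,
      indicatorVec_union (hm _) (hm _) hd h0 h1]
    simp only [add_apply, sub_apply, smul_apply, smul_eq_mul]
    generalize (μ.real (splitTree μ S (2 * n)) : 𝕜) = x at *
    generalize (μ.real (splitTree μ S (2 * n + 1)) : 𝕜) = y at *
    rw [inv_add_inv hx hy, inv_div]
    match_scalars <;> field_simp <;> ring

theorem treeProj_succ {n : ℕ} (hn : 1 ≤ n) (f : Lp 𝕜 p μ) :
    treeProj μ 𝕜 p S (n + 1) f = treeProj μ 𝕜 p S n f +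
      (haarConst μ 𝕜 S n * haarDual μ 𝕜 p S n f) • haarVec μ 𝕜 p S n := by
  rw [treeProj, treeProj, show 2 * (n + 1) = 2 * n + 1 + 1 by ring,
    Finset.sum_Ico_succ_top (by omega), Finset.sum_Ico_succ_top (by omega),
    Finset.sum_eq_sum_Ico_succ_bot (show n < 2 * n by omega), add_assoc,
    hS.averageVec_children hn]
  abel

theorem treeProj_one (f : Lp 𝕜 p μ) : treeProj μ 𝕜 p S 1 f = 0 := by
  simp [treeProj, splitTree_one, averageVec_of_top hS.measure_univ]

/-- The sum telescopes. It starts at zero because the whole space has infinite measure, so no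
constant function is needed in the basis. Tree numbers start at 1 and basis indices at 0. -/
theorem sum_haar (n : ℕ) (f : Lp 𝕜 p μ) :
    ∑ i ∈ Finset.range n, (haarConst μ 𝕜 S (i + 1) * haarDual μ 𝕜 p S (i + 1) f) •
      haarVec μ 𝕜 p S (i + 1) = treeProj μ 𝕜 p S (n + 1) f := by
  induction n with
  | zero => simp [hS.treeProj_one]
  | succ n ih => rw [Finset.sum_range_succ, ih, ← hS.treeProj_succ (by omega)]

/-- The set `k` contains both children of `n`, whose averages then cancel, or misses both. -/
theorem haarDual_indicatorVec {k n : ℕ} (hk : 1 ≤ k) (hn : 1 ≤ n) (h : k < 2 * n) :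
    haarDual μ 𝕜 p S n (indicatorVec μ 𝕜 p (splitTree μ S k)) = 0 := by
  by_cases hkt : μ (splitTree μ S k) = ∞
  · rw [indicatorVec_of_top hkt, map_zero]
  have hm := hS.measurableSet_splitTree
  have h0 := hS.measure_splitTree_two_mul hn
  have hx := hS.coe_measureReal_ne_zero (𝕜 := 𝕜) h0
  have s0 := splitTree_two_mul_subset (μ := μ) (S := S) hn
  have s1 := splitTree_two_mul_add_one_subset (μ := μ) (S := S) hn
  rw [haarDual, sub_apply, smul_apply, smul_apply, setIntegralDual_indicatorVec (hm _) h0 hkt]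
  rcases splitTree_subset_or_disjoint (μ := μ) (S := S) hk hn h with hsub | hdis
  · have hnt := measure_ne_top_of_subset hsub hkt
    have h1 := measure_ne_top_of_subset s1 hnt
    have hy := hS.coe_measureReal_ne_zero (𝕜 := 𝕜) h1
    rw [setIntegralDual_indicatorVec (hm _) h1 hkt,
      Set.inter_eq_left.2 (s0.trans hsub), Set.inter_eq_left.2 (s1.trans hsub)]
    simp [hx, hy]
  · rw [(hdis.mono_left s0).inter_eq]
    by_cases h1 : μ (splitTree μ S (2 * n + 1)) = ∞
    · simp [setIntegralDual_of_top h1]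
    · rw [setIntegralDual_indicatorVec (hm _) h1 hkt, (hdis.mono_left s1).inter_eq]
      simp

/-- The `i`-th Haar function is built from sets numbered below `2 * j`, so the `j`-th functional
kills it. The other half follows since pairing a set integral with an indicator is symmetric in the
two sets. -/
theorem haarDual_haarVec_of_lt {i j : ℕ} (hi : 1 ≤ i) (hij : i < j) :
    haarDual μ 𝕜 p S i (haarVec μ 𝕜 p S j) = 0 ∧ haarDual μ 𝕜 p S j (haarVec μ 𝕜 p S i) = 0 := by
  have hm := hS.measurableSet_splitTree
  have key : ∀ k, 1 ≤ k → k < 2 * j →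
      setIntegralDual μ 𝕜 p (splitTree μ S k) (haarVec μ 𝕜 p S j) = 0 := fun k hk hkj => by
    have := hS.haarDual_indicatorVec (𝕜 := 𝕜) (p := p) hk (hi.trans hij.le) hkj
    rwa [haarDual, sub_apply, smul_apply, smul_apply,
      setIntegralDual_indicatorVec_comm (hm _) (hm _),
      setIntegralDual_indicatorVec_comm (hm (2 * j + 1)) (hm k), ← map_smul, ← map_smul,
      ← map_sub] at this
  constructor
  · rw [haarDual, sub_apply, smul_apply, smul_apply, key _ (by omega) (by omega),
      key _ (by omega) (by omega)]
    simp
  · rw [haarVec, map_sub, map_smul, map_smul,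
      hS.haarDual_indicatorVec (by omega) (by omega) (by omega),
      hS.haarDual_indicatorVec (by omega) (by omega) (by omega)]
    simp

theorem haarDual_haarVec_self {n : ℕ} (hn : 1 ≤ n) :
    haarConst μ 𝕜 S n * haarDual μ 𝕜 p S n (haarVec μ 𝕜 p S n) = 1 := by
  have hm := hS.measurableSet_splitTree
  have h0 := hS.measure_splitTree_two_mul hn
  have hx := hS.coe_measureReal_ne_zero (𝕜 := 𝕜) h0
  have hd := splitTree_disjoint_children (μ := μ) (S := S) hn
  by_cases h1 : μ (splitTree μ S (2 * n + 1)) = ∞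
  · rw [haarConst, haarDual, haarVec, indicatorVec_of_top h1, sub_apply, smul_apply, smul_apply,
      setIntegralDual_of_top h1, zero_apply, smul_zero, smul_zero, sub_zero, sub_zero, map_smul,
      setIntegralDual_indicatorVec (hm _) h0 h0, Set.inter_self]
    have hy : (μ.real (splitTree μ S (2 * n + 1)) : 𝕜) = 0 := by simp [measureReal_def, h1]
    rw [hy]
    generalize (μ.real (splitTree μ S (2 * n)) : 𝕜) = x at *
    simp [hx]
  · have hy := hS.coe_measureReal_ne_zero (𝕜 := 𝕜) h1
    have hsum : μ.real (splitTree μ S (2 * n)) + μ.real (splitTree μ S (2 * n + 1)) ≠ 0 := by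
      rw [← measureReal_union hd (hm _) h0 h1, splitTree_union hn]
      exact_mod_cast hS.coe_measureReal_ne_zero (𝕜 := 𝕜) fun h =>
        h1 ((hS.measure_splitTree_two_mul_add_one hn).2 h)
    have hsum' : (μ.real (splitTree μ S (2 * n)) : 𝕜) + μ.real (splitTree μ S (2 * n + 1)) ≠ 0 := by
      exact_mod_cast hsum
    rw [haarConst, haarDual, haarVec]
    simp only [sub_apply, smul_apply, map_sub, map_smul, setIntegralDual_indicatorVec (hm _) h0 h0,
      setIntegralDual_indicatorVec (hm _) h0 h1, setIntegralDual_indicatorVec (hm _) h1 h0,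
      setIntegralDual_indicatorVec (hm _) h1 h1, Set.inter_self, hd.inter_eq, hd.symm.inter_eq,
      measureReal_empty, RCLike.ofReal_zero, smul_eq_mul]
    generalize (μ.real (splitTree μ S (2 * n)) : 𝕜) = x at *
    generalize (μ.real (splitTree μ S (2 * n + 1)) : 𝕜) = y at *
    rw [inv_add_inv hx hy, inv_div]
    field_simp
    ring

theorem coeFn_treeProj {n k : ℕ} (hn : 1 ≤ n) (hk : k ∈ Finset.Ico n (2 * n)) (f : Lp 𝕜 p μ) :
    ∀ᵐ x ∂μ.restrict (splitTree μ S k), treeProj μ 𝕜 p S n f x =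
      (μ.real (splitTree μ S k) : 𝕜)⁻¹ * setIntegralDual μ 𝕜 p (splitTree μ S k) f := by
  have hm := hS.measurableSet_splitTree
  rw [ae_restrict_iff' (hm k)]
  have h1 : ∀ᵐ x ∂μ, ∀ j ∈ Finset.Ico n (2 * n), averageVec μ 𝕜 p (splitTree μ S j) f x =
      (splitTree μ S j).indicator (fun _ => (μ.real (splitTree μ S j) : 𝕜)⁻¹ *
        setIntegralDual μ 𝕜 p (splitTree μ S j) f) x :=
    (Finset.eventually_all _).2 fun j _ => coeFn_averageVec (hm j) f
  filter_upwards [h1, Lp.coeFn_sum_apply (Finset.Ico n (2 * n))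
    fun j => averageVec μ 𝕜 p (splitTree μ S j) f] with x hx1 hx2 hxk
  rw [treeProj, hx2, Finset.sum_eq_single_of_mem k hk, hx1 k hk,
    Set.indicator_of_mem hxk]
  intro j hj hjk
  rw [hx1 j hj, Set.indicator_of_notMem]
  exact Set.disjoint_left.1 (splitTree_pairwiseDisjoint hn hk hj hjk.symm) hxk

/-- Jensen's inequality applies on each piece of the partition separately. -/
theorem norm_treeProj_le (hp : p ≠ ∞) {n : ℕ} (hn : 1 ≤ n) (f : Lp 𝕜 p μ) :
    ‖treeProj μ 𝕜 p S n f‖ ≤ ‖f‖ := by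
  have hm := hS.measurableSet_splitTree
  have hp0 : p ≠ 0 := (zero_lt_one.trans_le hp1.out).ne'
  rw [Lp.norm_def, Lp.norm_def]
  refine ENNReal.toReal_mono (Lp.eLpNorm_ne_top f) ?_
  rw [eLpNorm_eq_lintegral_rpow_enorm_toReal hp0 hp, eLpNorm_eq_lintegral_rpow_enorm_toReal hp0 hp]
  refine ENNReal.rpow_le_rpow ?_ (by positivity)
  have hsplit : ∀ u : α → ℝ≥0∞, ∫⁻ x, u x ∂μ =
      ∑ k ∈ Finset.Ico n (2 * n), ∫⁻ x in splitTree μ S k, u x ∂μ := fun u => by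
    rw [← lintegral_biUnion_finset (splitTree_pairwiseDisjoint hn) fun k _ => hm k,
      splitTree_biUnion hn, Measure.restrict_univ]
  rw [hsplit, hsplit]
  refine Finset.sum_le_sum fun k hk => ?_
  refine le_trans (le_of_eq ?_) (lintegral_average_rpow_le (A := splitTree μ S k) hp f)
  refine lintegral_congr_ae ?_
  filter_upwards [hS.coeFn_treeProj hn hk f] with x hx
  rw [hx]

end IsSplittingFamily

end HaarBasis

/-! ### Convergence of the partial sums, in `Lp` and against functionals. -/

section HaarBasis

variable {α : Type*} [MeasurableSpace α] {μ : Measure α} {𝕜 : Type*} [RCLike 𝕜]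
  {p : ℝ≥0∞} [hp1 : Fact (1 ≤ p)] {S : ℕ → Set α}

theorem treeProj_sub (n : ℕ) (f g : Lp 𝕜 p μ) :
    treeProj μ 𝕜 p S n (f - g) = treeProj μ 𝕜 p S n f - treeProj μ 𝕜 p S n g := by
  simp only [treeProj, averageVec, map_sub, mul_sub, sub_smul, Finset.sum_sub_distrib]

namespace IsSplittingFamily

variable (hS : IsSplittingFamily μ S)
include hS

theorem ae_of_ae_splitTree {n : ℕ} (hn : 1 ≤ n) {P : α → Prop}
    (h : ∀ k ∈ Finset.Ico n (2 * n), ∀ᵐ x ∂μ.restrict (splitTree μ S k), P x) : ∀ᵐ x ∂μ, P x := by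
  have h1 : ∀ᵐ x ∂μ, ∀ k ∈ Finset.Ico n (2 * n), x ∈ splitTree μ S k → P x :=
    (Finset.eventually_all _).2 fun k hk =>
      (ae_restrict_iff' (hS.measurableSet_splitTree k)).1 (h k hk)
  filter_upwards [h1] with x hx
  have hxu : x ∈ ⋃ k ∈ Finset.Ico n (2 * n), splitTree μ S k :=
    splitTree_biUnion (μ := μ) (S := S) hn ▸ Set.mem_univ x
  simp only [Set.mem_iUnion] at hxu
  obtain ⟨k, hk, hxk⟩ := hxu
  exact hx k hk hxk

theorem integral_eq_sum_splitTree {G : Type*} [NormedAddCommGroup G] [NormedSpace ℝ G] {n : ℕ}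
    (hn : 1 ≤ n) {v : α → G} (hv : Integrable v μ) :
    ∫ x, v x ∂μ = ∑ k ∈ Finset.Ico n (2 * n), ∫ x in splitTree μ S k, v x ∂μ := by
  rw [← integral_biUnion_finset _ (fun k _ => hS.measurableSet_splitTree k)
    (splitTree_pairwiseDisjoint hn) (fun k _ => hv.integrableOn), splitTree_biUnion hn,
    Measure.restrict_univ]

theorem norm_average_sub_le {k : ℕ} (hk : μ (splitTree μ S k) ≠ ∞) (f : Lp 𝕜 p μ) {c : 𝕜} {η : ℝ}
    (h : ∀ᵐ x ∂μ.restrict (splitTree μ S k), ‖f x - c‖ ≤ η) :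
    ‖(μ.real (splitTree μ S k) : 𝕜)⁻¹ * setIntegralDual μ 𝕜 p (splitTree μ S k) f - c‖ ≤ η := by
  have hx := hS.coe_measureReal_ne_zero (𝕜 := 𝕜) hk
  have hpos : 0 < μ.real (splitTree μ S k) :=
    lt_of_le_of_ne measureReal_nonneg fun h0 => hx (by rw [← h0, RCLike.ofReal_zero])
  have h1 := norm_setIntegral_le_of_norm_le_const_ae hk.lt_top h
  have : IsFiniteMeasure (μ.restrict (splitTree μ S k)) := ⟨by simpa using hk.lt_top⟩
  rw [integral_sub (Lp.integrableOn_of_measure_ne_top f hk) (integrable_const c),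
    setIntegral_const, ← setIntegralDual_apply hk, RCLike.real_smul_eq_coe_mul] at h1
  rw [show (μ.real (splitTree μ S k) : 𝕜)⁻¹ * setIntegralDual μ 𝕜 p (splitTree μ S k) f - c =
    (μ.real (splitTree μ S k) : 𝕜)⁻¹ * (setIntegralDual μ 𝕜 p (splitTree μ S k) f -
      μ.real (splitTree μ S k) * c) by field_simp, norm_mul, norm_inv, RCLike.norm_ofReal,
    abs_of_pos hpos, inv_mul_le_iff₀ hpos, mul_comm _ η]
  exact h1

variable [TopologicalSpace α] [IsLocallyFiniteMeasure μ]
  (hbasis : ∀ x, ∀ U, IsOpen U → x ∈ U → ∃ j, x ∈ S j ∧ S j ⊆ U) (hopen : ∀ j, IsOpen (S j))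
include hbasis hopen

/-- Deep pieces either miss the support, where function and average both vanish, or lie in `V`,
where both are within `η` of the same constant. The error is thus at most `2 * η` on `V` and zero
elsewhere. -/
theorem norm_treeProj_sub_le_of_hasCompactSupport {g : α → 𝕜} (hg : Continuous g)
    (hgc : HasCompactSupport g) (f : Lp 𝕜 p μ) (hfg : f =ᵐ[μ] g) {ε : ℝ} (hε : 0 < ε) :
    ∃ n₀, ∀ n, 1 ≤ n → n₀ ≤ n → ‖treeProj μ 𝕜 p S n f - f‖ ≤ ε := by
  obtain ⟨V, hKV, hV, hVfin⟩ := hgc.isCompact.exists_open_superset_measure_lt_top μ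
  set D : ℝ := (μ V ^ (1 / p.toReal)).toReal with hD
  have hDfin : μ V ^ (1 / p.toReal) ≠ ∞ := ENNReal.rpow_ne_top_of_nonneg (by positivity) hVfin.ne
  have hD0 : 0 ≤ D := ENNReal.toReal_nonneg
  obtain ⟨η, hη, hηε⟩ : ∃ η : ℝ, 0 < η ∧ (η + η) * D ≤ ε :=
    ⟨ε / (2 * (D + 1)), by positivity, by
      rw [← two_mul, mul_div_assoc', div_mul_eq_mul_div, div_le_iff₀ (by positivity)]
      nlinarith⟩
  obtain ⟨n₀, hn₀⟩ := hS.eventually_small_osc hbasis hopen hg hgc.isCompact hV hKV hη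
  refine ⟨n₀, fun n hn hnn => ?_⟩
  have key : ∀ᵐ x ∂μ, ‖treeProj μ 𝕜 p S n f x - f x‖ ≤ V.indicator (fun _ => η + η) x := by
    refine hS.ae_of_ae_splitTree hn fun k hk => ?_
    have hproj := hS.coeFn_treeProj hn hk f
    have hfg' := ae_restrict_of_ae (s := splitTree μ S k) hfg
    rcases hn₀ k (hnn.trans (Finset.mem_Ico.1 hk).1) with h | ⟨c, h⟩
    · have hf0 : ∀ᵐ x ∂μ.restrict (splitTree μ S k), f x = 0 := by
        filter_upwards [h, hfg'] with x h1 h2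
        rw [h2, image_eq_zero_of_notMem_tsupport h1]
      have hI : setIntegralDual μ 𝕜 p (splitTree μ S k) f = 0 := by
        by_cases hkt : μ (splitTree μ S k) = ∞
        · rw [setIntegralDual_of_top hkt, zero_apply]
        · rw [setIntegralDual_apply hkt, integral_eq_zero_of_ae hf0]
      filter_upwards [hproj, hf0] with x h1 h2
      rw [h1, h2, hI, mul_zero, sub_zero, norm_zero]
      exact Set.indicator_nonneg (fun _ _ => by positivity) x
    · have hkt : μ (splitTree μ S k) ≠ ∞ := by
        refine ne_top_of_le_ne_top hVfin.ne (measure_mono_ae ?_)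
        rw [ae_restrict_iff' (hS.measurableSet_splitTree k)] at h
        filter_upwards [h] with x hx hxk using (hx hxk).1
      have hav := hS.norm_average_sub_le hkt f (c := c) (η := η) (by
        filter_upwards [h, hfg'] with x h1 h2
        rw [h2]
        exact h1.2)
      filter_upwards [hproj, h, hfg'] with x h1 h2 h3
      rw [Set.indicator_of_mem h2.1, h1, h3]
      refine (norm_sub_le_norm_sub_add_norm_sub _ c _).trans (add_le_add hav ?_)
      rw [norm_sub_rev]
      exact h2.2
  rw [Lp.norm_def]
  have h1 : eLpNorm (treeProj μ 𝕜 p S n f - f : Lp 𝕜 p μ) p μ ≤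
      eLpNorm (V.indicator fun _ => η + η) p μ := by
    refine eLpNorm_mono_ae_real ?_
    filter_upwards [key, Lp.coeFn_sub (treeProj μ 𝕜 p S n f) f] with x h1 h2
    rwa [h2]
  have h2 := h1.trans (eLpNorm_indicator_const_le _ _)
  refine (ENNReal.toReal_mono (ENNReal.mul_ne_top enorm_ne_top hDfin) h2).trans ?_
  rw [ENNReal.toReal_mul, toReal_enorm, Real.norm_of_nonneg (by positivity)]
  exact hηε

variable [BorelSpace α]

theorem tendsto_treeProj [NormalSpace α] [R1Space α] [WeaklyLocallyCompactSpace α]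
    [μ.Regular] (hp : p ≠ ∞)
    (f : Lp 𝕜 p μ) : Tendsto (fun n => treeProj μ 𝕜 p S n f) atTop (𝓝 f) := by
  rw [Metric.tendsto_atTop]
  intro ε hε
  obtain ⟨g, hgc, hfg, hg, hgp⟩ := (Lp.memLp f).exists_hasCompactSupport_eLpNorm_sub_le hp
    (ε := ENNReal.ofReal (ε / 4)) (by simpa using hε)
  have hd : ‖f - hgp.toLp g‖ ≤ ε / 4 := by
    rw [Lp.norm_def]
    refine ENNReal.toReal_le_of_le_ofReal (by positivity) (le_trans (le_of_eq ?_) hfg)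
    refine eLpNorm_congr_ae ?_
    filter_upwards [Lp.coeFn_sub f (hgp.toLp g), hgp.coeFn_toLp] with x h1 h2
    rw [h1, Pi.sub_apply, h2, Pi.sub_apply]
  obtain ⟨n₀, hn₀⟩ := hS.norm_treeProj_sub_le_of_hasCompactSupport hbasis hopen hg hgc
    (hgp.toLp g) hgp.coeFn_toLp (ε := ε / 4) (by positivity)
  refine ⟨max n₀ 1, fun n hn => ?_⟩
  have hn1 : 1 ≤ n := (le_max_right _ _).trans hn
  have h1 := hn₀ n hn1 ((le_max_left _ _).trans hn)
  have h2 := hS.norm_treeProj_le hp hn1 (f - hgp.toLp g)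
  rw [dist_eq_norm, show treeProj μ 𝕜 p S n f - f = treeProj μ 𝕜 p S n (f - hgp.toLp g) +
    (treeProj μ 𝕜 p S n (hgp.toLp g) - hgp.toLp g) - (f - hgp.toLp g) by
      rw [treeProj_sub]; abel]
  refine ((norm_sub_le _ _).trans (add_le_add_left (norm_add_le _ _) _)).trans_lt ?_
  linarith

/-- Integration against a continuous function with small tails is approximated in norm by its
compositions with the averaging projections. -/
theorem norm_dual_sub_treeProj_le (hp : p ≠ ∞) {g : α → ℝ} (hg : Continuous g)
    (φ : StrongDual 𝕜 (Lp 𝕜 p μ)) (hint : ∀ f : Lp 𝕜 p μ, Integrable (fun x => g x • f x) μ)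
    (hφ : ∀ f : Lp 𝕜 p μ, φ f = ∫ x, g x • f x ∂μ)
    (htail : ∀ ε : ℝ, 0 < ε → ∃ K, IsCompact K ∧ MeasurableSet K ∧ ∀ f : Lp 𝕜 p μ,
      ∫ x in Kᶜ, ‖g x • f x‖ ∂μ ≤ ε * ‖f‖) {ε : ℝ} (hε : 0 < ε) :
    ∃ n₀, ∀ n, 1 ≤ n → n₀ ≤ n → ∀ f : Lp 𝕜 p μ, ‖φ (f - treeProj μ 𝕜 p S n f)‖ ≤ ε * ‖f‖ := by
  obtain ⟨K, hK, hKm, htailK⟩ := htail (ε / 4) (by positivity)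
  obtain ⟨V, hKV, hV, hVfin⟩ := hK.exists_open_superset_measure_lt_top μ
  obtain ⟨D, hD0, hD⟩ := Lp.exists_integral_norm_le μ 𝕜 p hVfin.ne
  obtain ⟨η, hη, hηε⟩ : ∃ η : ℝ, 0 < η ∧ η * D ≤ ε / 4 :=
    ⟨ε / (4 * (D + 1)), by positivity, by
      rw [div_mul_eq_mul_div, div_le_iff₀ (by positivity)]
      nlinarith⟩
  obtain ⟨n₀, hn₀⟩ := hS.eventually_small_osc hbasis hopen hg hK hV hKV hη
  refine ⟨n₀, fun n hn hnn f => ?_⟩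
  set u : Lp 𝕜 p μ := f - treeProj μ 𝕜 p S n f with hu
  have hun : ‖u‖ ≤ 2 * ‖f‖ := by
    refine (norm_sub_le _ _).trans ?_
    linarith [hS.norm_treeProj_le hp hn f]
  have hm := hS.measurableSet_splitTree
  have huV : IntegrableOn (fun x => ‖u x‖) V μ :=
    (Lp.integrableOn_of_measure_ne_top u hVfin.ne).norm
  -- The first term dominates on pieces where `g` is nearly constant, the second on pieces that miss
  -- `K`.
  let F : α → ℝ := V.indicator (fun x => η * ‖u x‖) + Kᶜ.indicator fun x => ‖g x • u x‖
  have hF1 : Integrable (V.indicator fun x => η * ‖u x‖) μ :=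
    (integrable_indicator_iff hV.measurableSet).2 (huV.const_mul η)
  have hF2 : Integrable (Kᶜ.indicator fun x => ‖g x • u x‖) μ :=
    (hint u).norm.indicator hKm.compl
  have hF : Integrable F μ := hF1.add hF2
  have hpiece : ∀ k ∈ Finset.Ico n (2 * n),
      ‖∫ x in splitTree μ S k, g x • u x ∂μ‖ ≤ ∫ x in splitTree μ S k, F x ∂μ := by
    intro k hk
    rcases hn₀ k (hnn.trans (Finset.mem_Ico.1 hk).1) with h | ⟨c, h⟩
    · refine norm_integral_le_of_norm_le hF.integrableOn ?_
      filter_upwards [h] with x hx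
      simp only [F, Pi.add_apply]
      rw [Set.indicator_of_mem (s := Kᶜ) hx]
      exact le_add_of_nonneg_left (Set.indicator_nonneg (fun _ _ => by positivity) x)
    · have hkt : μ (splitTree μ S k) ≠ ∞ := by
        refine ne_top_of_le_ne_top hVfin.ne (measure_mono_ae ?_)
        rw [ae_restrict_iff' (hm k)] at h
        filter_upwards [h] with x hx hxk using (hx hxk).1
      have hx0 := hS.coe_measureReal_ne_zero (𝕜 := 𝕜) hkt
      have : IsFiniteMeasure (μ.restrict (splitTree μ S k)) := ⟨by simpa using hkt.lt_top⟩
      -- Subtracting averages leaves mean zero on every finite piece, so `g` may be replaced there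
      -- by its small deviation `g - c`.
      have hu0 : ∫ x in splitTree μ S k, u x ∂μ = 0 := by
        have h1 : ∀ᵐ x ∂μ.restrict (splitTree μ S k), u x = f x -
            (μ.real (splitTree μ S k) : 𝕜)⁻¹ * setIntegralDual μ 𝕜 p (splitTree μ S k) f := by
          filter_upwards [hS.coeFn_treeProj hn hk f,
            ae_restrict_of_ae (Lp.coeFn_sub f (treeProj μ 𝕜 p S n f))] with x h1 h2
          rw [hu, h2, Pi.sub_apply, h1]
        rw [integral_congr_ae h1, integral_sub (Lp.integrableOn_of_measure_ne_top f hkt)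
          (integrable_const _), setIntegral_const, setIntegralDual_apply hkt,
          RCLike.real_smul_eq_coe_mul, mul_inv_cancel_left₀ hx0, sub_self]
      have h2 : ∫ x in splitTree μ S k, g x • u x ∂μ =
          ∫ x in splitTree μ S k, (g x - c) • u x ∂μ := by
        have hcu : Integrable (fun x => c • u x) (μ.restrict (splitTree μ S k)) :=
          (Lp.integrableOn_of_measure_ne_top u hkt).smul c
        simp_rw [sub_smul]
        rw [integral_sub (hint u).integrableOn hcu, integral_smul, hu0, smul_zero,
          sub_zero]
      rw [h2]
      refine norm_integral_le_of_norm_le hF.integrableOn ?_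
      filter_upwards [h] with x hx
      simp only [F, Pi.add_apply]
      rw [Set.indicator_of_mem hx.1, norm_smul]
      exact (mul_le_mul_of_nonneg_right hx.2 (norm_nonneg _)).trans
        (le_add_of_nonneg_right (Set.indicator_nonneg (fun _ _ => norm_nonneg _) x))
  have hsum : ‖φ u‖ ≤ ∫ x, F x ∂μ := by
    rw [hφ, hS.integral_eq_sum_splitTree hn (hint u),
      hS.integral_eq_sum_splitTree hn hF]
    exact norm_sum_le_of_le _ hpiece
  have hFint : ∫ x, F x ∂μ = η * ∫ x in V, ‖u x‖ ∂μ + ∫ x in Kᶜ, ‖g x • u x‖ ∂μ := by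
    rw [← integral_const_mul, ← integral_indicator hV.measurableSet,
      ← integral_indicator hKm.compl]
    exact integral_add hF1 hF2
  have h1 := mul_le_mul_of_nonneg_left (hD u) hη.le
  have h2 := htailK u
  have h3 := mul_le_mul_of_nonneg_right hηε (norm_nonneg u)
  calc ‖φ u‖ ≤ ε / 4 * ‖u‖ + ε / 4 * ‖u‖ := by
        rw [hFint] at hsum
        nlinarith
    _ = ε / 2 * ‖u‖ := by ring
    _ ≤ ε / 2 * (2 * ‖f‖) := by gcongr
    _ = ε * ‖f‖ := by ring

end IsSplittingFamily

/-- The Haar basis of `Lp` for a locally finite infinite measure without atoms. Integration against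
a continuous function with small tails lies in the closed span of its coordinate functionals. -/
theorem exists_haarBasis [TopologicalSpace α] [SecondCountableTopology α] [T1Space α] [NormalSpace α] [R1Space α]
    [WeaklyLocallyCompactSpace α] [BorelSpace α] [IsLocallyFiniteMeasure μ] [μ.Regular]
    [NullSingletonClass μ] (huniv : μ Set.univ = ∞) (hp : p ≠ ∞) :
    ∃ b : SchauderBasis 𝕜 (Lp 𝕜 p μ), ∀ (g : α → ℝ) (φ : StrongDual 𝕜 (Lp 𝕜 p μ)),
      Continuous g → (∀ f : Lp 𝕜 p μ, Integrable (fun x => g x • f x) μ) →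
      (∀ f : Lp 𝕜 p μ, φ f = ∫ x, g x • f x ∂μ) →
      (∀ ε : ℝ, 0 < ε → ∃ K, IsCompact K ∧ MeasurableSet K ∧ ∀ f : Lp 𝕜 p μ,
        ∫ x in Kᶜ, ‖g x • f x‖ ∂μ ≤ ε * ‖f‖) →
      Tendsto (fun n => ‖φ - φ.comp (b.proj n)‖) atTop (𝓝 0) := by
  obtain ⟨S, hS, hopen, hbasis⟩ := exists_isSplittingFamily μ huniv
  let b : SchauderBasis 𝕜 (Lp 𝕜 p μ) :=
    { basis := fun i => haarVec μ 𝕜 p S (i + 1)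
      coord := fun i => haarConst μ 𝕜 S (i + 1) • haarDual μ 𝕜 p S (i + 1)
      ortho := fun i j => by
        rw [smul_apply, smul_eq_mul]
        rcases lt_trichotomy i j with h | rfl | h
        · rw [(hS.haarDual_haarVec_of_lt (by omega) (by omega)).1, mul_zero]
          simp [Pi.single, Function.update, h.ne]
        · rw [hS.haarDual_haarVec_self (by omega)]
          simp [Pi.single, Function.update]
        · rw [(hS.haarDual_haarVec_of_lt (by omega) (by omega)).2, mul_zero]
          simp [Pi.single, Function.update, h.ne']
      expansion := fun f => by
        rw [HasSum, SummationFilter.conditional_filter_eq_map_range, tendsto_map'_iff]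
        refine ((tendsto_add_atTop_iff_nat 1).2
          (hS.tendsto_treeProj hbasis hopen hp f)).congr fun n => ?_
        exact (hS.sum_haar n f).symm }
  have hproj : ∀ n f, b.proj n f = treeProj μ 𝕜 p S (n + 1) f := fun n f => by
    rw [SchauderBasis.proj_apply]
    exact hS.sum_haar n f
  refine ⟨b, fun g φ hg hint hφ htail => ?_⟩
  rw [Metric.tendsto_atTop]
  intro ε hε
  obtain ⟨n₀, hn₀⟩ := hS.norm_dual_sub_treeProj_le hbasis hopen hp hg φ hint hφ htail
    (half_pos hε)
  refine ⟨n₀, fun n hn => ?_⟩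
  rw [dist_zero_right, norm_norm]
  refine lt_of_le_of_lt (ContinuousLinearMap.opNorm_le_bound _ (half_pos hε).le fun f => ?_)
    (half_lt_self hε)
  have := hn₀ (n + 1) (by omega) (by omega) f
  rwa [← hproj, map_sub] at this

end HaarBasis

/-! ### Taylor expansion of the Gaussian, uniform in the base point. -/

section GaussianTaylor

/-- For `|θ| ≤ 1` this is the usual remainder estimate. For `|θ| ≥ 1` the exponential and every term
of the sum are separately dominated by `|θ| ^ M`, so no factor growing exponentially in `θ` appears.
-/
theorem norm_cexp_mul_I_sub_sum_le (M : ℕ) (θ : ℝ) :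
    ‖Complex.exp (-(θ * Complex.I)) -
      ∑ j ∈ Finset.range M, (-(θ * Complex.I)) ^ j / (j.factorial : ℂ)‖ ≤
      (1 + Real.exp 1) * |θ| ^ M := by
  have hn : ‖-((θ : ℂ) * Complex.I)‖ = |θ| := by simp
  rcases le_total |θ| 1 with h | h
  · refine (Complex.norm_exp_sub_sum_le_norm_mul_exp _ M).trans ?_
    rw [hn, mul_comm]
    gcongr
    exact (Real.exp_le_exp.2 h).trans (by linarith)
  · refine (norm_sub_le _ _).trans ?_
    rw [add_mul, one_mul]
    refine add_le_add ?_ ?_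
    · rw [show -((θ : ℂ) * Complex.I) = ((-θ : ℝ) : ℂ) * Complex.I by push_cast; ring,
        Complex.norm_exp_ofReal_mul_I]
      exact one_le_pow₀ h
    · calc _ ≤ ∑ j ∈ Finset.range M, |θ| ^ M * (1 ^ j / (j.factorial : ℝ)) := by
            refine norm_sum_le_of_le _ fun j hj => ?_
            rw [norm_div, norm_pow, hn, RCLike.norm_natCast, one_pow, mul_one_div]
            gcongr
            exact (Finset.mem_range.1 hj).le
        _ ≤ Real.exp 1 * |θ| ^ M := by
            rw [← Finset.mul_sum, mul_comm]
            gcongr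
            exact Real.sum_le_exp_of_nonneg zero_le_one M

variable {E : Type*} [NormedAddCommGroup E] [InnerProductSpace ℝ E] [FiniteDimensional ℝ E]

open scoped RealInnerProductSpace

theorem integrable_norm_pow_mul_exp_neg_sq [MeasurableSpace E] [BorelSpace E] (M : ℕ) :
    Integrable fun v : E => ‖v‖ ^ M * Real.exp (-‖v‖ ^ 2) := by
  have h1 : Integrable fun v : E => Real.exp (-(1 / 2) * ‖v‖ ^ 2) := by
    have := (GaussianFourier.integrable_cexp_neg_mul_sq_norm_add (V := E) (b := (1 / 2 : ℂ))
      (by norm_num) 0 0).norm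
    refine this.congr (Eventually.of_forall fun v => ?_)
    simp only [Complex.norm_exp]
    congr 1
    simp [← Complex.ofReal_pow]
  obtain ⟨C, hC⟩ : ∃ C : ℝ, ∀ s : ℝ, 0 ≤ s → s ^ M * Real.exp (-(1 / 2) * s ^ 2) ≤ C := by
    refine ⟨M.factorial * Real.exp (1 / 2), fun s hs => ?_⟩
    have h2 := Real.pow_div_factorial_le_exp s hs M
    rw [div_le_iff₀ (by positivity)] at h2
    calc s ^ M * Real.exp (-(1 / 2) * s ^ 2)
        ≤ Real.exp s * M.factorial * Real.exp (-(1 / 2) * s ^ 2) := by gcongr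
      _ = M.factorial * Real.exp (s + -(1 / 2) * s ^ 2) := by rw [Real.exp_add]; ring
      _ ≤ _ := by
        gcongr
        nlinarith [sq_nonneg (s - 1)]
  refine (h1.const_mul C).mono' (by fun_prop) (Eventually.of_forall fun v => ?_)
  rw [Real.norm_of_nonneg (by positivity)]
  calc ‖v‖ ^ M * Real.exp (-‖v‖ ^ 2)
      = ‖v‖ ^ M * Real.exp (-(1 / 2) * ‖v‖ ^ 2) * Real.exp (-(1 / 2) * ‖v‖ ^ 2) := by
        rw [mul_assoc, ← Real.exp_add]; congr 2; ring
    _ ≤ C * Real.exp (-(1 / 2) * ‖v‖ ^ 2) := by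
        gcongr
        exact hC _ (norm_nonneg v)

omit [FiniteDimensional ℝ E] in
-- Monomials are indexed by words `σ` rather than multi-indices, which avoids multinomial
-- coefficients.
theorem inner_pow_eq_sum {ι : Type*} [Fintype ι] (b : OrthonormalBasis ι ℝ E) (y v : E) (j : ℕ) :
    ⟪y, v⟫ ^ j = ∑ σ : Fin j → ι, (∏ l, b.repr v (σ l)) * ∏ l, b.repr y (σ l) := by
  rw [← b.sum_inner_mul_inner y v, ← Fin.prod_const j, Fintype.prod_sum]
  refine Finset.sum_congr rfl fun σ _ => ?_
  rw [← Finset.prod_mul_distrib]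
  refine Finset.prod_congr rfl fun l _ => ?_
  rw [b.repr_apply_apply, b.repr_apply_apply, real_inner_comm, mul_comm]

omit [FiniteDimensional ℝ E] in
theorem norm_prod_repr_le {ι : Type*} [Fintype ι] (b : OrthonormalBasis ι ℝ E) (y : E) {j : ℕ}
    (σ : Fin j → ι) : ‖∏ l, b.repr y (σ l)‖ ≤ ‖y‖ ^ j := by
  rw [norm_prod]
  calc _ ≤ ∏ _l : Fin j, ‖y‖ := Finset.prod_le_prod (fun _ _ => norm_nonneg _) fun l _ => by
        rw [← b.repr.norm_map y]
        exact PiLp.norm_apply_le _ _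
    _ = ‖y‖ ^ j := by simp

omit [FiniteDimensional ℝ E] in
theorem norm_prod_repr_le_one_add {ι : Type*} [Fintype ι] (b : OrthonormalBasis ι ℝ E) (y : E)
    {j : ℕ} (σ : Fin j → ι) : ‖∏ l, b.repr y (σ l)‖ ≤ (1 + ‖y‖) ^ j :=
  (norm_prod_repr_le b y σ).trans (pow_le_pow_left₀ (norm_nonneg y) (by simp) j)

/-- Taylor expansion of the Gaussian with a remainder that is uniform in the base point. -/
theorem exists_gaussian_taylor {ι : Type*} [Fintype ι] (b : OrthonormalBasis ι ℝ E) (M : ℕ) :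
    ∃ C : ℝ, ∀ z : E, ∃ a : (j : ℕ) → (Fin j → ι) → ℝ, ∀ y : E,
      |Real.exp (-‖z - y‖ ^ 2 / 4) -
        ∑ j ∈ Finset.range M, ∑ σ : Fin j → ι, a j σ * ∏ l, b.repr y (σ l)| ≤ C * ‖y‖ ^ M := by
  let _ : MeasurableSpace E := borel E
  have : BorelSpace E := ⟨rfl⟩
  -- The Gaussian is written as the Fourier transform of a Gaussian. A shift by `y` multiplies the
  -- integrand by `exp (-i ⟪y, v⟫)`, which is expanded in `y`; `z` enters only through a factor of
  -- modulus one, so the remainder does not see it.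
  let c₀ : ℂ := ((Real.pi : ℂ) ^ (Module.finrank ℝ E / 2 : ℂ))⁻¹
  let k : E → E → ℂ := fun z v => Complex.exp (-(1 : ℂ) * ‖v‖ ^ 2 + Complex.I * ⟪z, v⟫)
  have hknorm : ∀ z v, ‖k z v‖ = Real.exp (-‖v‖ ^ 2) := fun z v => by
    simp only [k, Complex.norm_exp]
    congr 1
    simp [← Complex.ofReal_pow]
  have hkcont : ∀ z, Continuous (k z) := fun z => by fun_prop
  have hint : ∀ z, Integrable (k z) := fun z =>
    GaussianFourier.integrable_cexp_neg_mul_sq_norm_add (by simp) _ _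
  have hgauss : ∀ z : E, ((Real.exp (-‖z‖ ^ 2 / 4) : ℝ) : ℂ) = c₀ * ∫ v, k z v := fun z => by
    have hpi : (Real.pi : ℂ) ^ (Module.finrank ℝ E / 2 : ℂ) ≠ 0 := by
      rw [Complex.cpow_ne_zero_iff]
      left
      exact_mod_cast Real.pi_ne_zero
    simp only [k]
    rw [GaussianFourier.integral_cexp_neg_mul_sq_norm_add (by simp), div_one,
      inv_mul_cancel_left₀ hpi]
    simp
  let A : (z : E) → (j : ℕ) → (Fin j → ι) → E → ℂ := fun z j σ v =>
    k z v * ((-Complex.I) ^ j / (j.factorial : ℂ)) * ((∏ l, b.repr v (σ l) : ℝ) : ℂ)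
  have hAint : ∀ z j σ, Integrable (A z j σ) := fun z j σ => by
    refine ((integrable_norm_pow_mul_exp_neg_sq (E := E) j).mono' ?_
      (Eventually.of_forall fun v => ?_))
    · have := hkcont z
      exact Continuous.aestronglyMeasurable (by fun_prop)
    · simp only [A]
      rw [norm_mul, norm_mul, hknorm, norm_div, norm_pow, norm_neg, Complex.norm_I, one_pow,
        Complex.norm_real, mul_comm]
      have h1 := norm_prod_repr_le b v σ
      have h2 : 1 / ‖(j.factorial : ℂ)‖ ≤ 1 := by
        rw [RCLike.norm_natCast]
        exact (div_le_one (by positivity)).2 (by exact_mod_cast j.factorial_pos)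
      calc _ ≤ ‖v‖ ^ j * (Real.exp (-‖v‖ ^ 2) * 1) := by gcongr
        _ = _ := by ring
  let D : ℝ := ‖c₀‖ * ∫ v : E, (1 + Real.exp 1) * (‖v‖ ^ M * Real.exp (-‖v‖ ^ 2))
  -- Real parts suffice, since the Gaussian and the monomials in `y` are real.
  refine ⟨D, fun z => ⟨fun j σ => (c₀ * ∫ v, A z j σ v).re, fun y => ?_⟩⟩
  have hpoly : ∑ j ∈ Finset.range M, ∑ σ : Fin j → ι,
      (c₀ * ∫ v, A z j σ v) * ((∏ l, b.repr y (σ l) : ℝ) : ℂ) =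
      c₀ * ∫ v, k z v * ∑ j ∈ Finset.range M,
        (-((⟪y, v⟫ : ℝ) * Complex.I)) ^ j / (j.factorial : ℂ) := by
    have h1 : ∀ v, k z v * ∑ j ∈ Finset.range M,
        (-((⟪y, v⟫ : ℝ) * Complex.I)) ^ j / (j.factorial : ℂ) =
        ∑ j ∈ Finset.range M, ∑ σ : Fin j → ι, A z j σ v * ((∏ l, b.repr y (σ l) : ℝ) : ℂ) := by
      intro v
      rw [Finset.mul_sum]
      refine Finset.sum_congr rfl fun j _ => ?_
      rw [← mul_neg, mul_pow, ← Complex.ofReal_pow, inner_pow_eq_sum b]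
      push_cast
      rw [Finset.sum_mul, Finset.sum_div, Finset.mul_sum]
      refine Finset.sum_congr rfl fun σ _ => ?_
      simp only [A]
      push_cast
      ring
    simp_rw [h1]
    rw [integral_finsetSum _ fun j _ => integrable_finsetSum _ fun σ _ =>
      (hAint z j σ).mul_const _, Finset.mul_sum]
    refine Finset.sum_congr rfl fun j _ => ?_
    rw [integral_finsetSum _ fun σ _ => (hAint z j σ).mul_const _, Finset.mul_sum]
    refine Finset.sum_congr rfl fun σ _ => ?_
    rw [integral_mul_const, mul_assoc]
  have hpolyint : Integrable fun v => k z v * ∑ j ∈ Finset.range M,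
      (-((⟪y, v⟫ : ℝ) * Complex.I)) ^ j / (j.factorial : ℂ) := by
    simp_rw [Finset.mul_sum]
    refine integrable_finsetSum _ fun j _ => ?_
    refine (integrable_norm_pow_mul_exp_neg_sq (E := E) j).const_mul (‖y‖ ^ j) |>.mono' ?_
      (Eventually.of_forall fun v => ?_)
    · have := hkcont z
      exact Continuous.aestronglyMeasurable (by fun_prop)
    · rw [norm_mul, hknorm, norm_div, norm_pow, norm_neg, norm_mul, Complex.norm_I, mul_one,
        Complex.norm_real, RCLike.norm_natCast, mul_comm]
      have h2 : ‖⟪y, v⟫‖ ^ j / (j.factorial : ℝ) ≤ (‖y‖ * ‖v‖) ^ j / 1 := by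
        gcongr
        · exact norm_inner_le_norm _ _
        · exact_mod_cast j.factorial_pos
      calc _ ≤ (‖y‖ * ‖v‖) ^ j / 1 * Real.exp (-‖v‖ ^ 2) := by gcongr
        _ = _ := by rw [mul_pow]; ring
  have hk : ∀ v, k (z - y) v = k z v * Complex.exp (-((⟪y, v⟫ : ℝ) * Complex.I)) := fun v => by
    simp only [k]
    rw [← Complex.exp_add, inner_sub_left]
    congr 1
    push_cast
    ring
  have hre : Real.exp (-‖z - y‖ ^ 2 / 4) - ∑ j ∈ Finset.range M, ∑ σ : Fin j → ι,
      (c₀ * ∫ v, A z j σ v).re * ∏ l, b.repr y (σ l) =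
      (c₀ * ∫ v, k z v * (Complex.exp (-((⟪y, v⟫ : ℝ) * Complex.I)) - ∑ j ∈ Finset.range M,
        (-((⟪y, v⟫ : ℝ) * Complex.I)) ^ j / (j.factorial : ℂ))).re := by
    simp_rw [mul_sub, ← hk]
    rw [integral_sub (hint _) hpolyint, mul_sub, ← hgauss, ← hpoly, Complex.sub_re,
      Complex.ofReal_re, Complex.re_sum]
    congr 1
    refine Finset.sum_congr rfl fun j _ => ?_
    rw [Complex.re_sum]
    refine Finset.sum_congr rfl fun σ _ => ?_
    rw [Complex.re_mul_ofReal]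
  rw [hre]
  refine (Complex.abs_re_le_norm _).trans ?_
  rw [norm_mul]
  simp only [D]
  rw [mul_assoc, ← integral_mul_const]
  gcongr
  refine norm_integral_le_of_norm_le
    (((integrable_norm_pow_mul_exp_neg_sq M).const_mul _).mul_const _)
    (Eventually.of_forall fun v => ?_)
  rw [norm_mul, hknorm]
  have h1 := norm_cexp_mul_I_sub_sum_le M ⟪y, v⟫
  have h2 : |⟪y, v⟫| ^ M ≤ (‖y‖ * ‖v‖) ^ M := by
    gcongr
    exact abs_real_inner_le_norm _ _
  calc _ ≤ Real.exp (-‖v‖ ^ 2) * ((1 + Real.exp 1) * (‖y‖ * ‖v‖) ^ M) := by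
        gcongr
        exact h1.trans (by gcongr)
    _ = _ := by rw [mul_pow]; ring

end GaussianTaylor

/-! ### Fast growing weights: powers, moments and embeddings. -/

section Weights

theorem weightedMeasure_absolutelyContinuous {E : Type*} [MeasureSpace E] (w : E → ℝ) :
    weightedMeasure w ≪ (volume : Measure E) :=
  withDensity_absolutelyContinuous _ _

namespace IsFastGrowingWeight

variable {E : Type*} [NormedAddCommGroup E] {w : E → ℝ} (hw : IsFastGrowingWeight w)
include hw

theorem exists_rpow_le (r : ℝ) : ∃ C : ℝ, 0 < C ∧ ∀ x, (1 + ‖x‖) ^ r ≤ C * w x := by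
  obtain ⟨C, hC⟩ := hw.fast ⌈r⌉₊
  refine ⟨max C 1, by positivity, fun x => ?_⟩
  have h1 : 1 / w x * (1 + ‖x‖) ^ ⌈r⌉₊ ≤ C := hC ⟨x, rfl⟩
  have hpos := hw.pos x
  calc (1 + ‖x‖) ^ r ≤ (1 + ‖x‖) ^ ((⌈r⌉₊ : ℕ) : ℝ) :=
        Real.rpow_le_rpow_of_exponent_le (by simp) (Nat.le_ceil r)
    _ = (1 / w x * (1 + ‖x‖) ^ ⌈r⌉₊) * w x := by rw [Real.rpow_natCast]; field_simp
    _ ≤ max C 1 * w x := by gcongr; exact h1.trans (le_max_left _ _)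

theorem rpow {s : ℝ} (hs : 0 < s) : IsFastGrowingWeight fun x => w x ^ s where
  continuous := hw.continuous.rpow_const fun x => Or.inl (hw.pos x).ne'
  pos x := Real.rpow_pos_of_pos (hw.pos x) s
  symm x := by rw [hw.symm]
  fast m := by
    obtain ⟨C, hC, h⟩ := hw.exists_rpow_le (m / s)
    refine ⟨C ^ s, ?_⟩
    rintro _ ⟨x, rfl⟩
    have hpos := Real.rpow_pos_of_pos (hw.pos x) s
    have h1 := Real.rpow_le_rpow (by positivity) (h x) hs.le
    rw [← Real.rpow_mul (by positivity), div_mul_cancel₀ _ hs.ne', Real.rpow_natCast,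
      Real.mul_rpow hC.le (hw.pos x).le] at h1
    change 1 / w x ^ s * (1 + ‖x‖) ^ m ≤ C ^ s
    rw [one_div, inv_mul_le_iff₀ hpos, mul_comm]
    exact h1

variable [MeasureSpace E] [BorelSpace E]

theorem volume_absolutelyContinuous : (volume : Measure E) ≪ weightedMeasure w := by
  refine withDensity_absolutelyContinuous' ?_ (Eventually.of_forall fun x => ?_)
  · exact (ENNReal.measurable_ofReal.comp hw.continuous.measurable).aemeasurable
  · simpa using hw.pos x

theorem lintegral_weightedMeasure (f : E → ℝ≥0∞) :
    ∫⁻ x, f x ∂weightedMeasure w = ∫⁻ x, ENNReal.ofReal (w x) * f x :=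
  lintegral_withDensity_eq_lintegral_mul_non_measurable _
    (ENNReal.measurable_ofReal.comp hw.continuous.measurable)
    (Eventually.of_forall fun _ => ENNReal.ofReal_lt_top) f

variable [NormedSpace ℝ E] [FiniteDimensional ℝ E] [(volume : Measure E).IsAddHaarMeasure]

theorem isLocallyFiniteMeasure : IsLocallyFiniteMeasure (weightedMeasure w) :=
  IsLocallyFiniteMeasure.withDensity_ofReal hw.continuous

theorem weightedMeasure_univ [Nontrivial E] : weightedMeasure w Set.univ = ∞ := by
  obtain ⟨C, hC, h⟩ := hw.exists_rpow_le 0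
  rw [← lintegral_one, hw.lintegral_weightedMeasure, eq_top_iff]
  have : NoncompactSpace E := NormedSpace.noncompactSpace ℝ E
  calc (∞ : ℝ≥0∞) = ∫⁻ _ : E, ENNReal.ofReal C⁻¹ := by
        rw [lintegral_const, measure_univ_of_isAddLeftInvariant, ENNReal.mul_top]
        simpa using hC
    _ ≤ _ := by
        refine lintegral_mono fun x => ?_
        rw [mul_one]
        refine ENNReal.ofReal_le_ofReal ?_
        have := h x
        rw [Real.rpow_zero] at this
        exact (inv_le_iff_one_le_mul₀' hC).2 this

/-- Hölder's inequality in the weighted space. -/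
theorem exists_lintegral_mul_le {𝕜 : Type*} [RCLike 𝕜] {p : ℝ≥0∞} [hp1 : Fact (1 ≤ p)]
    (hp : p ≠ ∞) {v : E → ℝ} (hv : Continuous v) (hv0 : ∀ x, 0 ≤ v x) {C : ℝ} (hC : 0 ≤ C)
    (hvw : ∀ x, ((1 + ‖x‖) ^ (Module.finrank ℝ E + 1) * v x) ^ p.toReal ≤ C * w x) :
    ∃ D : ℝ, 0 ≤ D ∧ ∀ f : E → 𝕜, AEStronglyMeasurable f (weightedMeasure w) →
      ∫⁻ x, ENNReal.ofReal (v x) * ‖f x‖ₑ ≤ ENNReal.ofReal D * eLpNorm f p (weightedMeasure w) := by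
  have hp0 : p ≠ 0 := (zero_lt_one.trans_le hp1.out).ne'
  have hpr : 1 ≤ p.toReal := by simpa using ENNReal.toReal_mono hp hp1.out
  set r : ℝ := Module.finrank ℝ E + 1 with hr
  -- The exponent exceeds the dimension, so `ρ` is the density of a finite measure `l`. Hölder on
  -- `l` is applied to `u = ρ⁻¹ * v * f`, and `ρ ≤ 1` compares its `p`-th power integral with that
  -- of `f` against `w`.
  let ρ : E → ℝ≥0∞ := fun x => ENNReal.ofReal ((1 + ‖x‖) ^ (-r))
  have hρm : Measurable ρ := by fun_prop
  let l : Measure E := volume.withDensity ρ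
  have hl : ∀ g : E → ℝ≥0∞, ∫⁻ x, g x ∂l = ∫⁻ x, ρ x * g x :=
    lintegral_withDensity_eq_lintegral_mul_non_measurable _ hρm
      (Eventually.of_forall fun _ => ENNReal.ofReal_lt_top)
  have hlfin : l Set.univ ≠ ∞ := by
    rw [← lintegral_one, hl]
    simp only [mul_one]
    exact (finite_integral_one_add_norm (μ := (volume : Measure E)) (r := r) (by simp [hr])).ne
  have hρ1 : ∀ x, ρ x ≤ 1 := fun x => by
    rw [← ENNReal.ofReal_one]
    refine ENNReal.ofReal_le_ofReal (Real.rpow_le_one_of_one_le_of_nonpos (by simp) ?_)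
    rw [neg_nonpos]
    positivity
  let D₀ : ℝ≥0∞ := ENNReal.ofReal C ^ (1 / p.toReal) *
    l Set.univ ^ (1 / (1 : ℝ≥0∞).toReal - 1 / p.toReal)
  have hD₀ : D₀ ≠ ∞ := by
    refine ENNReal.mul_ne_top (ENNReal.rpow_ne_top_of_nonneg (by positivity) ENNReal.ofReal_ne_top)
      (ENNReal.rpow_ne_top_of_nonneg ?_ hlfin)
    have : 1 / p.toReal ≤ 1 := (div_le_one (by linarith)).2 hpr
    simpa using this
  refine ⟨D₀.toReal, ENNReal.toReal_nonneg, fun f hf => ?_⟩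
  rw [ENNReal.ofReal_toReal hD₀]
  have hfv : AEStronglyMeasurable f volume := hf.mono_ac hw.volume_absolutelyContinuous
  let u : E → 𝕜 := fun x => ((1 + ‖x‖) ^ r * v x) • f x
  have hu : AEStronglyMeasurable u l := by
    refine AEStronglyMeasurable.mono_ac (withDensity_absolutelyContinuous _ _) ?_
    refine AEStronglyMeasurable.smul (Continuous.aestronglyMeasurable ?_) hfv
    refine Continuous.mul (Continuous.rpow_const (by fun_prop) fun x => Or.inl ?_) hv
    positivity
  have hun : ∀ x, ‖u x‖ₑ = ENNReal.ofReal ((1 + ‖x‖) ^ r * v x) * ‖f x‖ₑ := fun x => by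
    rw [enorm_smul, Real.enorm_eq_ofReal (mul_nonneg (by positivity) (hv0 x))]
  have h1 := eLpNorm_le_eLpNorm_mul_rpow_measure_univ hp1.out hu
  rw [eLpNorm_one_eq_lintegral_enorm, hl, eLpNorm_eq_lintegral_rpow_enorm_toReal hp0 hp] at h1
  have h2 : ∫⁻ x, ρ x * ‖u x‖ₑ = ∫⁻ x, ENNReal.ofReal (v x) * ‖f x‖ₑ := by
    refine lintegral_congr fun x => ?_
    rw [hun, ← mul_assoc, ← ENNReal.ofReal_mul (by positivity), ← mul_assoc,
      ← Real.rpow_add (by positivity), neg_add_cancel, Real.rpow_zero, one_mul]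
  have h3 : ∫⁻ x, ‖u x‖ₑ ^ p.toReal ∂l ≤
      ENNReal.ofReal C * ∫⁻ x, ‖f x‖ₑ ^ p.toReal ∂weightedMeasure w := by
    rw [hl, hw.lintegral_weightedMeasure, ← lintegral_const_mul' _ _ ENNReal.ofReal_ne_top]
    refine lintegral_mono fun x => ?_
    calc ρ x * ‖u x‖ₑ ^ p.toReal ≤ 1 * ‖u x‖ₑ ^ p.toReal := by gcongr; exact hρ1 x
      _ = ENNReal.ofReal (((1 + ‖x‖) ^ r * v x) ^ p.toReal) * ‖f x‖ₑ ^ p.toReal := by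
        rw [one_mul, hun, ENNReal.mul_rpow_of_nonneg _ _ (by linarith),
          ENNReal.ofReal_rpow_of_nonneg (mul_nonneg (by positivity) (hv0 x)) (by linarith)]
      _ ≤ ENNReal.ofReal (C * w x) * ‖f x‖ₑ ^ p.toReal := by
        gcongr
        have := hvw x
        rwa [← Real.rpow_natCast, Nat.cast_add, Nat.cast_one, ← hr] at this
      _ = _ := by rw [ENNReal.ofReal_mul hC, mul_assoc]
  rw [← h2]
  refine h1.trans ?_
  rw [eLpNorm_eq_lintegral_rpow_enorm_toReal hp0 hp]
  calc _ ≤ (ENNReal.ofReal C * ∫⁻ x, ‖f x‖ₑ ^ p.toReal ∂weightedMeasure w) ^ (1 / p.toReal) *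
        l Set.univ ^ (1 / (1 : ℝ≥0∞).toReal - 1 / p.toReal) := by gcongr
    _ = _ := by
      rw [ENNReal.mul_rpow_of_nonneg _ _ (by positivity)]
      simp only [D₀]
      ring

/-- All moments are controlled by the weighted norm. -/
theorem exists_lintegral_moment_le {𝕜 : Type*} [RCLike 𝕜] {p : ℝ≥0∞} [hp1 : Fact (1 ≤ p)]
    (hp : p ≠ ∞) (m : ℕ) : ∃ D : ℝ, 0 ≤ D ∧ ∀ f : Lp 𝕜 p (weightedMeasure w),
      ∫⁻ x, ENNReal.ofReal ((1 + ‖x‖) ^ m) * ‖f x‖ₑ ≤ ENNReal.ofReal (D * ‖f‖) := by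
  obtain ⟨C, hC, h⟩ := hw.exists_rpow_le ((Module.finrank ℝ E + 1 + m : ℕ) * p.toReal)
  obtain ⟨D, hD, hDf⟩ := hw.exists_lintegral_mul_le (𝕜 := 𝕜) hp (v := fun x => (1 + ‖x‖) ^ m)
    (by fun_prop) (fun x => by positivity) hC.le fun x => by
      rw [← pow_add, ← Real.rpow_natCast, ← Real.rpow_mul (by positivity)]
      exact h x
  refine ⟨D, hD, fun f => (hDf f (Lp.aestronglyMeasurable f)).trans (le_of_eq ?_)⟩
  rw [ENNReal.ofReal_mul hD, Lp.norm_def, ENNReal.ofReal_toReal (Lp.eLpNorm_ne_top f)]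

/-- The weighted `L^p` space embeds into a weighted `L^1` space. -/
theorem memLp_one_of_memLp {𝕜 : Type*} [RCLike 𝕜] {p : ℝ≥0∞} [hp1 : Fact (1 ≤ p)]
    (hp : p ≠ ∞) {f : E → 𝕜} (hf : MemLp f p (weightedMeasure w)) :
    MemLp f 1 (weightedMeasure fun x => w x ^ (1 / (2 * p.toReal))) := by
  have hpr : 1 ≤ p.toReal := by simpa using ENNReal.toReal_mono hp hp1.out
  have hw' := hw.rpow (s := 1 / (2 * p.toReal)) (by positivity)
  -- The `p`-th power of the new weight is `w ^ (1 / 2)`; the other factor `w ^ (1 / 2)` absorbs the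
  -- polynomial.
  obtain ⟨C, hC, h⟩ := (hw.rpow (s := 1 / 2) (by norm_num)).exists_rpow_le
    ((Module.finrank ℝ E + 1 : ℕ) * p.toReal)
  obtain ⟨D, hD, hDf⟩ := hw.exists_lintegral_mul_le (𝕜 := 𝕜) hp hw'.continuous
    (fun x => (hw'.pos x).le) hC.le fun x => by
      have hwx := hw.pos x
      rw [Real.mul_rpow (by positivity) (by positivity), ← Real.rpow_mul hwx.le,
        ← Real.rpow_natCast, ← Real.rpow_mul (by positivity),
        show 1 / (2 * p.toReal) * p.toReal = 1 / 2 by field_simp]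
      calc _ ≤ C * w x ^ (1 / 2 : ℝ) * w x ^ (1 / 2 : ℝ) := by
            gcongr
            exact h x
        _ = C * w x := by rw [mul_assoc, ← Real.rpow_add hwx]; norm_num
  refine ⟨(hf.1.mono_ac hw.volume_absolutelyContinuous).mono_ac
    (weightedMeasure_absolutelyContinuous _), ?_⟩
  rw [eLpNorm_one_eq_lintegral_enorm, hw'.lintegral_weightedMeasure]
  exact (hDf f hf.1).trans_lt (ENNReal.mul_lt_top ENNReal.ofReal_lt_top hf.2)

end IsFastGrowingWeight

end Weights

/-! ### Moment functionals and decay of the heat semigroup. -/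

section FastDecay

namespace IsFastGrowingWeight

variable {E : Type*} [NormedAddCommGroup E] {w : E → ℝ} (hw : IsFastGrowingWeight w)
  [MeasureSpace E] [BorelSpace E]
  {𝕜 : Type*} [RCLike 𝕜] {p : ℝ≥0∞} [hp1 : Fact (1 ≤ p)]

include hw in
theorem integral_weightedMeasure (f : E → 𝕜) (A : Set E) (hA : MeasurableSet A) :
    ∫ x in A, f x ∂weightedMeasure w = ∫ x in A, w x • f x := by
  rw [weightedMeasure, restrict_withDensity hA,
    integral_withDensity_eq_integral_toReal_smul
      hw.continuous.measurable.ennreal_ofReal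
      (Eventually.of_forall fun _ => ENNReal.ofReal_lt_top)]
  exact integral_congr_ae (Eventually.of_forall fun x => by
    simp only [ENNReal.toReal_ofReal (hw.pos x).le])

include hw in
theorem integrable_weightedMeasure_iff (f : E → 𝕜) :
    Integrable f (weightedMeasure w) ↔ Integrable (fun x => w x • f x) := by
  rw [weightedMeasure, integrable_withDensity_iff_integrable_smul'
    hw.continuous.measurable.ennreal_ofReal
    (Eventually.of_forall fun _ => ENNReal.ofReal_lt_top)]
  simp only [ENNReal.toReal_ofReal (hw.pos _).le]

variable [NormedSpace ℝ E] [FiniteDimensional ℝ E] [(volume : Measure E).IsAddHaarMeasure]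

include hw in
theorem exists_integral_moment_le (hp : p ≠ ∞) (m : ℕ) :
    ∃ D : ℝ, 0 ≤ D ∧ ∀ f : Lp 𝕜 p (weightedMeasure w),
      Integrable (fun x => (1 + ‖x‖) ^ m * ‖f x‖) ∧ ∫ x, (1 + ‖x‖) ^ m * ‖f x‖ ≤ D * ‖f‖ := by
  obtain ⟨D, hD, h⟩ := hw.exists_lintegral_moment_le (𝕜 := 𝕜) hp m
  refine ⟨D, hD, fun f => ?_⟩
  have hf : AEStronglyMeasurable f volume :=
    (Lp.aestronglyMeasurable f).mono_ac hw.volume_absolutelyContinuous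
  have hm : AEStronglyMeasurable (fun x => (1 + ‖x‖) ^ m * ‖f x‖) volume :=
    (Continuous.aestronglyMeasurable (by fun_prop)).mul hf.norm
  have he : ∀ x, ‖(1 + ‖x‖) ^ m * ‖f x‖‖ₑ = ENNReal.ofReal ((1 + ‖x‖) ^ m) * ‖f x‖ₑ := fun x => by
    rw [enorm_mul, enorm_norm, Real.enorm_eq_ofReal (by positivity)]
  have hle : ∫⁻ x, ‖(1 + ‖x‖) ^ m * ‖f x‖‖ₑ ≤ ENNReal.ofReal (D * ‖f‖) := by
    simp_rw [he]
    exact h f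
  have hi : Integrable (fun x => (1 + ‖x‖) ^ m * ‖f x‖) :=
    ⟨hm, hle.trans_lt ENNReal.ofReal_lt_top⟩
  refine ⟨hi, ?_⟩
  rw [← ENNReal.ofReal_le_ofReal_iff (by positivity),
    ofReal_integral_eq_lintegral_ofReal hi (Eventually.of_forall fun x => by positivity)]
  refine le_trans (lintegral_mono fun x => ?_) hle
  rw [Real.enorm_eq_ofReal (by positivity)]

include hw in
theorem integrable_mul_of_le (hp : p ≠ ∞) {q : E → ℝ} (hq : Continuous q) {m : ℕ}
    (hqm : ∀ x, |q x| ≤ (1 + ‖x‖) ^ m) (f : Lp 𝕜 p (weightedMeasure w)) :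
    Integrable fun x => q x • f x := by
  obtain ⟨D, -, h⟩ := hw.exists_integral_moment_le (𝕜 := 𝕜) (p := p) hp m
  refine (h f).1.mono' (hq.aestronglyMeasurable.smul
    ((Lp.aestronglyMeasurable f).mono_ac hw.volume_absolutelyContinuous))
    (Eventually.of_forall fun x => ?_)
  rw [norm_smul]
  exact mul_le_mul_of_nonneg_right (hqm x) (norm_nonneg _)

/-- Integration against a continuous function of polynomial growth, as a functional on the weighted
space. -/
noncomputable def momentDual (hw : IsFastGrowingWeight w) (hp : p ≠ ∞) {q : E → ℝ}
    (hq : Continuous q) {m : ℕ} (hqm : ∀ x, |q x| ≤ (1 + ‖x‖) ^ m) :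
    StrongDual 𝕜 (Lp 𝕜 p (weightedMeasure w)) :=
  LinearMap.mkContinuousOfExistsBound
    { toFun := fun f => ∫ x, q x • f x
      map_add' := fun f g => by
        rw [← integral_add (hw.integrable_mul_of_le hp hq hqm f)
          (hw.integrable_mul_of_le hp hq hqm g)]
        refine integral_congr_ae ?_
        filter_upwards [hw.volume_absolutelyContinuous.ae_le (Lp.coeFn_add f g)] with x hx
        rw [hx, Pi.add_apply, smul_add]
      map_smul' := fun c f => by
        rw [RingHom.id_apply, ← integral_smul]
        refine integral_congr_ae ?_
        filter_upwards [hw.volume_absolutelyContinuous.ae_le (Lp.coeFn_smul c f)] with x hx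
        rw [hx, Pi.smul_apply, smul_comm] } (by
    obtain ⟨D, -, h⟩ := hw.exists_integral_moment_le (𝕜 := 𝕜) (p := p) hp m
    refine ⟨D, fun f => (norm_integral_le_of_norm_le (h f).1
      (Eventually.of_forall fun x => ?_)).trans (h f).2⟩
    rw [norm_smul]
    exact mul_le_mul_of_nonneg_right (hqm x) (norm_nonneg _))

theorem momentDual_apply (hp : p ≠ ∞) {q : E → ℝ} (hq : Continuous q) {m : ℕ}
    (hqm : ∀ x, |q x| ≤ (1 + ‖x‖) ^ m) (f : Lp 𝕜 p (weightedMeasure w)) :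
    hw.momentDual hp hq hqm f = ∫ x, q x • f x := rfl

include hw in
/-- Every sequence of functionals of polynomial growth is annihilated by the tails of a suitable
Schauder basis. -/
theorem exists_basis_annihilating_moments [Nontrivial E] (hp : p ≠ ∞) (q : ℕ → E → ℝ)
    (hq : ∀ k, Continuous (q k)) (m : ℕ → ℕ) (hqm : ∀ k x, |q k x| ≤ (1 + ‖x‖) ^ m k) :
    ∃ b : SchauderBasis 𝕜 (Lp 𝕜 p (weightedMeasure w)), ∀ k, ∃ n,
      ∀ f : Lp 𝕜 p (weightedMeasure w), (∀ i < n, b.coord i f = 0) → ∫ x, q k x • f x = 0 := by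
  have : IsLocallyFiniteMeasure (weightedMeasure w) := hw.isLocallyFiniteMeasure
  have : NullSingletonClass (weightedMeasure w) := nullSingletonClass_withDensity _
  have : ProperSpace E := FiniteDimensional.proper ℝ E
  obtain ⟨b, hb⟩ := exists_haarBasis (𝕜 := 𝕜) (p := p) (μ := weightedMeasure w)
    hw.weightedMeasure_univ hp
  have hcancel : ∀ k (f : Lp 𝕜 p (weightedMeasure w)) x,
      w x • (q k x / w x) • f x = q k x • f x := fun k f x => by
    rw [smul_smul, mul_div_cancel₀ _ (hw.pos x).ne']
  obtain ⟨b', hb'⟩ := b.exists_basis_annihilating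
    (fun k => hw.momentDual hp (hq k) (hqm k)) fun k => by
      refine hb (fun x => q k x / w x) _
        ((hq k).div hw.continuous fun x => (hw.pos x).ne') (fun f => ?_) (fun f => ?_) ?_
      · rw [hw.integrable_weightedMeasure_iff]
        simp_rw [hcancel]
        exact hw.integrable_mul_of_le hp (hq k) (hqm k) f
      · rw [momentDual_apply, ← setIntegral_univ,
          ← setIntegral_univ (μ := weightedMeasure w),
          hw.integral_weightedMeasure _ _ MeasurableSet.univ]
        simp_rw [hcancel]
      · intro ε hε
        -- One extra moment makes the tail beyond radius `R` at most `D / R` times the norm; `D + 1`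
        -- keeps the radius positive.
        obtain ⟨D, hD, hDf⟩ := hw.exists_integral_moment_le (𝕜 := 𝕜) (p := p) hp (m k + 1)
        refine ⟨Metric.closedBall 0 ((D + 1) / ε), isCompact_closedBall _ _,
          Metric.isClosed_closedBall.measurableSet, fun f => ?_⟩
        have hbound : ∀ x ∈ (Metric.closedBall (0 : E) ((D + 1) / ε))ᶜ,
            (D + 1) * ‖q k x • f x‖ ≤ ε * ((1 + ‖x‖) ^ (m k + 1) * ‖f x‖) := fun x hx => by
          have hx' : (D + 1) / ε < ‖x‖ := by simpa using hx
          rw [div_lt_iff₀ hε] at hx'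
          rw [norm_smul, pow_succ]
          calc (D + 1) * (‖q k x‖ * ‖f x‖) ≤ (‖x‖ * ε) * ((1 + ‖x‖) ^ m k * ‖f x‖) := by
                gcongr
                exact hqm k x
            _ = ε * (1 + ‖x‖) ^ m k * ‖x‖ * ‖f x‖ := by ring
            _ ≤ ε * (1 + ‖x‖) ^ m k * (1 + ‖x‖) * ‖f x‖ := by
                gcongr
                linarith
            _ = _ := by ring
        have hD1 : 0 < D + 1 := by linarith
        have hm : MeasurableSet (Metric.closedBall (0 : E) ((D + 1) / ε))ᶜ :=
          Metric.isClosed_closedBall.measurableSet.compl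
        rw [hw.integral_weightedMeasure (𝕜 := ℝ) _ _ hm]
        have hnorm : ∀ x, w x • ‖(q k x / w x) • f x‖ = ‖q k x • f x‖ := fun x => by
          rw [← hcancel, norm_smul (w x), Real.norm_of_nonneg (hw.pos x).le, smul_eq_mul]
        simp_rw [hnorm]
        refine le_of_mul_le_mul_left ?_ hD1
        rw [← integral_const_mul]
        calc _ ≤ ∫ x in (Metric.closedBall (0 : E) ((D + 1) / ε))ᶜ,
              ε * ((1 + ‖x‖) ^ (m k + 1) * ‖f x‖) :=
              setIntegral_mono_on
                ((hw.integrable_mul_of_le hp (hq k) (hqm k) f).norm.const_mul _).integrableOn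
                ((hDf f).1.const_mul _).integrableOn hm hbound
          _ ≤ ∫ x, ε * ((1 + ‖x‖) ^ (m k + 1) * ‖f x‖) :=
              setIntegral_le_integral ((hDf f).1.const_mul _)
                (Eventually.of_forall fun x => by positivity)
          _ ≤ (D + 1) * (ε * ‖f‖) := by
              rw [integral_const_mul]
              have := (hDf f).2
              have h0 := norm_nonneg f
              nlinarith [mul_nonneg hε.le h0, mul_le_mul_of_nonneg_left this hε.le]
  exact ⟨b', fun k => hb' k⟩

end IsFastGrowingWeight

variable {E : Type*} [NormedAddCommGroup E] [InnerProductSpace ℝ E] [FiniteDimensional ℝ E]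
  [MeasureSpace E] [BorelSpace E] [(volume : Measure E).IsAddHaarMeasure]
  {𝕜 : Type*} [RCLike 𝕜]

omit [(volume : Measure E).IsAddHaarMeasure] in
/-- The heat semigroup decays fast on data all of whose moments of low order vanish. -/
theorem exists_norm_heatSemigroup_le {ι : Type*} [Fintype ι] (b : OrthonormalBasis ι ℝ E) (m : ℕ) :
    ∃ C : ℝ, 0 ≤ C ∧ ∀ f : E → 𝕜, AEStronglyMeasurable f volume →
      (∀ j, Integrable fun y => (1 + ‖y‖) ^ j * ‖f y‖) →
      (∀ j < 2 * m, ∀ σ : Fin j → ι, ∫ y, (∏ l, b.repr y (σ l)) • f y = 0) →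
      ∀ t : ℝ, 1 ≤ t → ∀ x, ‖heatSemigroup t f x‖ ≤
        C / t ^ m * ∫ y, (1 + ‖y‖) ^ (2 * m) * ‖f y‖ := by
  obtain ⟨C, hC⟩ := exists_gaussian_taylor b (2 * m)
  refine ⟨max C 0, le_max_right _ _, fun f hf hint hmom t ht x => ?_⟩
  have ht0 : 0 < t := by linarith
  have hs : 0 < √t := Real.sqrt_pos.2 ht0
  -- Rescaling by `√t` reduces to the fixed Gaussian, and the remainder of order `2 * m` yields the
  -- factor `t ^ (-m)`.
  obtain ⟨a, ha⟩ := hC ((√t)⁻¹ • x)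
  have hprod : ∀ j (σ : Fin j → ι) y, ∏ l, b.repr ((√t)⁻¹ • y) (σ l) =
      (√t)⁻¹ ^ j * ∏ l, b.repr y (σ l) := fun j σ y => by
    simp [Finset.prod_mul_distrib]
  have hexp : ∀ y, Real.exp (-‖(√t)⁻¹ • x - (√t)⁻¹ • y‖ ^ 2 / 4) =
      Real.exp (-‖x - y‖ ^ 2 / (4 * t)) := fun y => by
    rw [← smul_sub, norm_smul, mul_pow, norm_inv, Real.norm_of_nonneg hs.le, inv_pow,
      Real.sq_sqrt ht0.le]
    congr 1
    field_simp
  have hmon : ∀ j (σ : Fin j → ι), Integrable fun y => (∏ l, b.repr y (σ l)) • f y := fun j σ => by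
    refine (hint j).mono' ((Continuous.aestronglyMeasurable (by fun_prop)).smul hf)
      (Eventually.of_forall fun y => ?_)
    rw [norm_smul]
    gcongr
    exact norm_prod_repr_le_one_add b y σ
  have hmon' : ∀ (c : ℝ) j (σ : Fin j → ι),
      Integrable fun y => c • (∏ l, b.repr y (σ l)) • f y := fun c j σ => (hmon j σ).smul c
  let P : E → ℝ := fun y => ∑ j ∈ Finset.range (2 * m), ∑ σ : Fin j → ι,
    a j σ * ∏ l, b.repr ((√t)⁻¹ • y) (σ l)
  have hPf : ∀ y, P y • f y = ∑ j ∈ Finset.range (2 * m), ∑ σ : Fin j → ι,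
      (a j σ * (√t)⁻¹ ^ j) • (∏ l, b.repr y (σ l)) • f y := fun y => by
    simp only [P, Finset.sum_smul, hprod, smul_smul, mul_assoc]
  have hPi : Integrable fun y => P y • f y := by
    simp_rw [hPf]
    exact integrable_finsetSum _ fun j _ => integrable_finsetSum _ fun σ _ => hmon' _ j σ
  have hP0 : ∫ y, P y • f y = 0 := by
    simp_rw [hPf]
    rw [integral_finsetSum _ fun j _ => integrable_finsetSum _ fun σ _ => hmon' _ j σ]
    refine Finset.sum_eq_zero fun j hj => ?_
    rw [integral_finsetSum _ fun σ _ => hmon' _ j σ]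
    refine Finset.sum_eq_zero fun σ _ => ?_
    rw [integral_smul, hmom j (Finset.mem_range.1 hj) σ, smul_zero]
  have hGi : Integrable fun y => Real.exp (-‖x - y‖ ^ 2 / (4 * t)) • f y := by
    refine (hint 0).mono' ((Continuous.aestronglyMeasurable (by fun_prop)).smul hf)
      (Eventually.of_forall fun y => ?_)
    rw [norm_smul, pow_zero]
    gcongr
    rw [Real.norm_of_nonneg (Real.exp_pos _).le, Real.exp_le_one_iff]
    exact div_nonpos_of_nonpos_of_nonneg (by simp) (by positivity)
  have hI : ‖∫ y, Real.exp (-‖x - y‖ ^ 2 / (4 * t)) • f y‖ ≤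
      max C 0 / t ^ m * ∫ y, (1 + ‖y‖) ^ (2 * m) * ‖f y‖ := by
    rw [← sub_zero (∫ y, _), ← hP0, ← integral_sub hGi hPi, ← integral_const_mul]
    refine norm_integral_le_of_norm_le ((hint (2 * m)).const_mul _)
      (Eventually.of_forall fun y => ?_)
    rw [← sub_smul, norm_smul, ← mul_assoc]
    gcongr
    have h1 := ha ((√t)⁻¹ • y)
    rw [hexp] at h1
    refine h1.trans ?_
    rw [norm_smul, norm_inv, Real.norm_of_nonneg hs.le, mul_pow, inv_pow, pow_mul √t,
      Real.sq_sqrt ht0.le, ← mul_assoc, ← div_eq_mul_inv]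
    gcongr
    · exact le_max_left _ _
    · linarith
  -- The normalising factor is at most one for `t ≥ 1`, so its own decay is discarded.
  have hc : ((4 * Real.pi * t) ^ (-(Module.finrank ℝ E : ℝ) / 2) : ℝ) ≤ 1 := by
    refine Real.rpow_le_one_of_one_le_of_nonpos ?_ ?_
    · nlinarith [Real.pi_gt_three]
    · exact div_nonpos_of_nonpos_of_nonneg (by simp) (by norm_num)
  rw [heatSemigroup, norm_smul, Real.norm_of_nonneg (by positivity)]
  exact (mul_le_of_le_one_left (norm_nonneg _) hc).trans hI

/-- The coordinate monomials of all degrees are countable, so one basis serves them all. For each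
`m` only the finitely many of degree below `2 * m` matter, and the largest of their thresholds is
the required index. -/
theorem IsFastGrowingWeight.exists_hasFastDecay [Nontrivial E] {p : ℝ≥0∞} [hp1 : Fact (1 ≤ p)]
    (hp : p ≠ ∞) {w : E → ℝ} (hw : IsFastGrowingWeight w) :
    ∃ b : SchauderBasis 𝕜 (Lp 𝕜 p (weightedMeasure w)), HasFastDecay b := by
  let B := stdOrthonormalBasis ℝ E
  let I := Σ j : ℕ, (Fin j → Fin (Module.finrank ℝ E))
  have : Nonempty I := ⟨⟨0, Fin.elim0⟩⟩
  obtain ⟨e, he⟩ := exists_surjective_nat I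
  obtain ⟨b, hb⟩ := hw.exists_basis_annihilating_moments (𝕜 := 𝕜) hp
    (fun k y => ∏ l, B.repr y ((e k).2 l)) (fun k => by fun_prop) (fun k => (e k).1)
    fun k y => norm_prod_repr_le_one_add B y _
  have hb' : ∀ j (σ : Fin j → Fin (Module.finrank ℝ E)), ∃ n,
      ∀ f : Lp 𝕜 p (weightedMeasure w), (∀ i < n, b.coord i f = 0) →
        ∫ y, (∏ l, B.repr y (σ l)) • f y = 0 := fun j σ => by
    obtain ⟨k, hk⟩ := he ⟨j, σ⟩
    obtain ⟨n, hn⟩ := hb k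
    rw [hk] at hn
    exact ⟨n, hn⟩
  choose n hn using hb'
  refine ⟨b, fun m => ?_⟩
  obtain ⟨C, hC, hheat⟩ := exists_norm_heatSemigroup_le (𝕜 := 𝕜) B m
  obtain ⟨D, hD, hDf⟩ := hw.exists_integral_moment_le (𝕜 := 𝕜) (p := p) hp (2 * m)
  refine ⟨(Finset.range (2 * m)).sup fun j => Finset.univ.sup (n j), C * D, fun f hf => ?_⟩
  have hfm : AEStronglyMeasurable f volume :=
    (Lp.aestronglyMeasurable f).mono_ac hw.volume_absolutelyContinuous
  have hint : ∀ j, Integrable fun y => (1 + ‖y‖) ^ j * ‖f y‖ := fun j =>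
    ((hw.exists_integral_moment_le (𝕜 := 𝕜) (p := p) hp j).choose_spec.2 f).1
  refine ⟨?_, fun t ht => iSup_le fun x => ?_⟩
  · have := hint 0
    simp only [pow_zero, one_mul] at this
    exact (integrable_norm_iff hfm).1 this
  · rw [← ofReal_norm]
    refine ENNReal.ofReal_le_ofReal ((hheat f hfm hint (fun j hj σ => hn j σ f fun i hi => hf i
      (hi.trans_le ?_)) t ht x).trans ?_)
    · exact (Finset.le_sup (f := n j) (Finset.mem_univ σ)).trans
        (Finset.le_sup (f := fun j => Finset.univ.sup (n j)) (Finset.mem_range.2 hj))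
    · calc _ ≤ C / t ^ m * (D * ‖f‖) := by
            gcongr
            exact (hDf f).2
        _ = _ := by ring

end FastDecay

theorem theorem1p1 {𝕜 : Type*} [RCLike 𝕜] (p : ℝ≥0∞) [Fact (1 ≤ p)] (hp : p ≠ ∞) :
    (∀ w : ℝ → ℝ, IsFastGrowingWeight w →
      ∃ b : SchauderBasis 𝕜 (Lp 𝕜 p (weightedMeasure w)), HasFastDecay b) ∧
    (∀ N : ℕ, 1 < N → ∀ w : EuclideanSpace ℝ (Fin N) → ℝ, IsFastGrowingWeight w →
      ∃ w' : EuclideanSpace ℝ (Fin N) → ℝ, IsFastGrowingWeight w' ∧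
        (∀ f : EuclideanSpace ℝ (Fin N) → 𝕜,
          MemLp f p (weightedMeasure w) → MemLp f 1 (weightedMeasure w')) ∧
        ∃ b : SchauderBasis 𝕜 (Lp 𝕜 1 (weightedMeasure w')), HasFastDecay b) := by
  refine ⟨fun w hw => hw.exists_hasFastDecay hp, fun N hN w hw => ?_⟩
  have : NeZero N := ⟨by omega⟩
  have hp0 : p ≠ 0 := (zero_lt_one.trans_le (Fact.out : 1 ≤ p)).ne'
  have hw' := hw.rpow (s := 1 / (2 * p.toReal)) (by have := ENNReal.toReal_pos hp0 hp; positivity)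
  exact ⟨_, hw', fun f hf => hw.memLp_one_of_memLp hp hf,
    hw'.exists_hasFastDecay ENNReal.one_ne_top⟩
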